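/- All graphs are finite and simple. A bipartitioned graph is a graph whose vertices are each coloured white or black so that adjacent vertices have different colours; a bipartitioned forest is an acyclic one. Let $\Sigma_n$ be the symmetric group on $\{1,\dots,n\}$. For a bipartitioned graph $G$ with $n$ edges, order its edges $e_1,\dots,e_n$, and let $\Sigma_n$ permute them through their indices. Let $R_G\subseteq\Sigma_n$ be the subgroup of those permutations that preserve the white endpoint of every edge, let $C_G\subseteq\Sigma_n$ be the subgroup of those that preserve the black endpoint of every edge, and put \[R(G)=\sum_{\sigma\in R_G}\sigma,\qquad C(G)=\sum_{\sigma\in C_G}\operatorname{sgn}(\sigma)\,\sigma .\] The Specht module of $G$ is the left ideal $S^G=\mathbf C[\Sigma_n]\,C(G)\,R(G)$ of the group algebra $\mathbf C[\Sigma_n]$ (up to isomorphism it does not depend on the ordering of the edges). Let $H$ be a bipartitioned graph and let $v_1,v_2$ be two non-adjacent vertices of $H$ of different colours. Let $G$ be obtained from $H$ by adding pendant edges $\overline{v_1v_1'}$ and $\overline{v_2v_2'}$, where $v_1',v_2'$ are new vertices; let $G_1$ be obtained from $H$ by adding a pendant edge $\overline{v_1v_1'}$ and the edge $\overline{v_1v_2}$;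 and let $G_2$ be obtained from $H$ by adding a pendant edge $\overline{v_2v_2'}$ and the edge $\overline{v_1v_2}$. Each of the three graphs keeps the colours of the vertices of $H$, and each new vertex has the colour opposite to that of its neighbour. **Corollary.** Suppose that $G$, $G_1$ and $G_2$ are forests. Then they have the same number $n$ of edges, and, whatever orderings of their edges are used to form the Specht modules, \[S^G\cong S^{G_1}\oplus S^{G_2}\] as $\mathbf C[\Sigma_n]$-modules, i.e. as complex representations of $\Sigma_n$. -/

import Mathlib

open scoped BigOperators

section Diagrams

/-- The subgroup of permutations of the (ordered) boxes of the diagram `D` that stabilize each row.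
A diagram is a set of boxes `(i, j)`, with `i` the row and `j` the column; rows and columns may be
indexed by arbitrary types. `e` is the chosen ordering of the `n` boxes of `D`. -/
def rowStabilizer {α β : Type*} {D : Set (α × β)} {n : ℕ} (e : Fin n ≃ D) :
    Subgroup (Equiv.Perm (Fin n)) where
  carrier := {σ | ∀ i, (e (σ i)).1.1 = (e i).1.1}
  mul_mem' := fun {a b} ha hb i => (ha (b i)).trans (hb i)
  one_mem' := fun _ => rfl
  inv_mem' := fun {a} ha i => by
    have h := ha (a⁻¹ i)
    rw [← Equiv.Perm.mul_apply, mul_inv_cancel, Equiv.Perm.one_apply] at h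
    exact h.symm

/-- The subgroup of permutations of the (ordered) boxes of `D` that stabilize each column. -/
def columnStabilizer {α β : Type*} {D : Set (α × β)} {n : ℕ} (e : Fin n ≃ D) :
    Subgroup (Equiv.Perm (Fin n)) where
  carrier := {σ | ∀ i, (e (σ i)).1.2 = (e i).1.2}
  mul_mem' := fun {a b} ha hb i => (ha (b i)).trans (hb i)
  one_mem' := fun _ => rfl
  inv_mem' := fun {a} ha i => by
    have h := ha (a⁻¹ i)
    rw [← Equiv.Perm.mul_apply, mul_inv_cancel, Equiv.Perm.one_apply] at h
    exact h.symm

/-- `R(D)`, the sum of the row stabilizer in the group algebra. -/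
noncomputable def rowSum {α β : Type*} {D : Set (α × β)} {n : ℕ} (e : Fin n ≃ D) :
    MonoidAlgebra ℂ (Equiv.Perm (Fin n)) :=
  open Classical in
  ∑ σ : Equiv.Perm (Fin n) with σ ∈ rowStabilizer e, MonoidAlgebra.single σ (1 : ℂ)

/-- `C(D)`, the signed sum of the column stabilizer in the group algebra. -/
noncomputable def columnSum {α β : Type*} {D : Set (α × β)} {n : ℕ} (e : Fin n ≃ D) :
    MonoidAlgebra ℂ (Equiv.Perm (Fin n)) :=
  open Classical in
  ∑ σ : Equiv.Perm (Fin n) with σ ∈ columnStabilizer e,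
    MonoidAlgebra.single σ (((Equiv.Perm.sign σ : ℤˣ) : ℤ) : ℂ)

/-- The Specht module of `D`: the left ideal of `ℂ[Σₙ]` generated by `C(D) R(D)`. -/
noncomputable def spechtModule {α β : Type*} {D : Set (α × β)} {n : ℕ} (e : Fin n ≃ D) :
    Ideal (MonoidAlgebra ℂ (Equiv.Perm (Fin n))) :=
  Ideal.span {columnSum e * rowSum e}

end Diagrams

/-- A graph with a fixed proper colouring of its vertices: `true` is white, `false` is black. -/
structure BipartitionedGraph (V : Type*) where
  graph : SimpleGraph V
  color : V → Bool
  proper : ∀ u v, graph.Adj u v → color u ≠ color v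

namespace BipartitionedGraph

/-- The diagram of a bipartitioned graph: rows are indexed by the white vertices, columns by the
black vertices, and there is a box `(w, b)` for each edge joining a white `w` to a black `b`. -/
def diagram {V : Type*} (G : BipartitionedGraph V) : Set (V × V) :=
  {p | G.color p.1 = true ∧ G.color p.2 = false ∧ G.graph.Adj p.1 p.2}

/-- Add a new vertex `none`, of the colour opposite to that of `v`, joined to `v` only. -/
def addPendant {V : Type*} (G : BipartitionedGraph V) (v : V) :
    BipartitionedGraph (Option V) where
  graph :=
    { Adj := fun x y =>
        match x, y with
        | some a, some b => G.graph.Adj a b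
        | some a, none => a = v
        | none, some b => b = v
        | none, none => False
      symm := ⟨by
        rintro (_ | a) (_ | b) h
        · exact h
        · exact h
        · exact h
        · exact SimpleGraph.Adj.symm h⟩
      loopless := ⟨by
        rintro (_ | a) h
        · exact h
        · exact G.graph.irrefl h⟩ }
  color := fun x =>
    match x with
    | some a => G.color a
    | none => !(G.color v)
  proper := by
    rintro (_ | a) (_ | b) h
    · exact h.elim
    · obtain rfl : b = v := h
      simp
    · obtain rfl : a = v := h
      simp
    · exact G.proper a b h

/-- Add an edge between two vertices of opposite colours. -/
def addEdge {V : Type*} (G : BipartitionedGraph V) (u v : V) (h : G.color u ≠ G.color v) :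
    BipartitionedGraph V where
  graph := G.graph ⊔ SimpleGraph.edge u v
  color := G.color
  proper := by
    intro a b hab
    rcases hab with hab | hab
    · exact G.proper a b hab
    · rw [SimpleGraph.edge_adj] at hab
      rcases hab.1 with ⟨rfl, rfl⟩ | ⟨rfl, rfl⟩
      · exact h
      · exact h.symm

/-- The graph `G` of the leaf recurrence: `H` with pendant edges at `v₁` and at `v₂`. -/
def leafG {V : Type*} (H : BipartitionedGraph V) (v₁ v₂ : V) :
    BipartitionedGraph (Option (Option V)) :=
  (H.addPendant v₁).addPendant (some v₂)

/-- The graph `G₁` of the leaf recurrence: `H` with the edge `v₁v₂` and a pendant edge at `v₁`. -/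
def leafG₁ {V : Type*} (H : BipartitionedGraph V) (v₁ v₂ : V) (h : H.color v₁ ≠ H.color v₂) :
    BipartitionedGraph (Option V) :=
  (H.addEdge v₁ v₂ h).addPendant v₁

/-- The graph `G₂` of the leaf recurrence: `H` with the edge `v₁v₂` and a pendant edge at `v₂`. -/
def leafG₂ {V : Type*} (H : BipartitionedGraph V) (v₁ v₂ : V) (h : H.color v₁ ≠ H.color v₂) :
    BipartitionedGraph (Option V) :=
  (H.addEdge v₁ v₂ h).addPendant v₂

end BipartitionedGraph

/-! Everything is done for bipartite multigraphs given by endpoint functions `x` (white) and `y`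
(black) on the edges. Let `p` be the pendant edge at the white vertex of the pair and `q` the one at
the black vertex. Moving the white end of `q` to that of `p` gives one child of `G`; moving the
black end of `p` to that of `q` gives the other. Write `M` for n! times the volume of the matching
polytope.

Algebra: right multiplication by the row sum of the first child maps the Specht module of `G` onto
that of the first child. It kills the Specht module of the second, which sits inside that of `G`,
because `p` and `q` have become parallel. So the dimensions of the children add up to at most that
of `G` (`spechtDim_add_le`), and by semisimplicity equality yields the direct sum.

Geometry: the hyperplane z_p = z_q cuts the polytope of `G` into two pieces, each of which a
volume-preserving shear puts inside the polytope of one child. So `M` of `G` is at most the sum over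
the children (`matchingVolume_le_add`). It remains to prove dim = `M` for forests.

`M` ≤ dim (`matchingVolume_le_spechtDim`): a forest has a matching `N` that covers every vertex of
degree at least two and meets every edge. Coning from the indicator vector of `N` bounds `M` of the
graph by the sum of `M` over the deletions of single edges of `N`. A triangularity argument on
polytabloids shows that the dimensions of their spans satisfy the reverse inequality.

dim ≤ `M` (`spechtDim_le_matchingVolume`): for disjoint edges `M` = n!, the largest possible
dimension. Any other forest is a child of a forest with one more vertex, and its sibling is a forest
too. The two recurrence inequalities then sandwich, and the contribution of the sibling cancels by
`M` ≤ dim. -/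

/-! ### Character-weighted subgroup sums in a group algebra. -/

section TwistedSums

open Classical in
/-- The sum of the elements of a subgroup of a finite group, weighted by a linear character. -/
noncomputable def twistedSum {G : Type*} [Group G] [Fintype G] (χ : G →* ℂ) (K : Subgroup G) :
    MonoidAlgebra ℂ G :=
  ∑ σ : G with σ ∈ K, MonoidAlgebra.single σ (χ σ)

theorem char_mul_inv {G : Type*} [Group G] (χ : G →* ℂ) (σ : G) : χ σ * χ σ⁻¹ = 1 := by
  rw [← map_mul, mul_inv_cancel, map_one]

variable {G : Type*} [Group G] [Fintype G] (χ : G →* ℂ) {K L : Subgroup G}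

theorem single_mul_twistedSum {τ : G} (hτ : τ ∈ K) :
    MonoidAlgebra.single τ (χ τ) * twistedSum χ K = twistedSum χ K := by
  classical
  unfold twistedSum
  rw [Finset.mul_sum]
  refine Finset.sum_bij' (fun σ _ => τ * σ) (fun σ _ => τ⁻¹ * σ) ?_ ?_ ?_ ?_ ?_
  · intro σ hσ
    simp only [Finset.mem_filter, Finset.mem_univ, true_and] at hσ ⊢
    exact K.mul_mem hτ hσ
  · intro σ hσ
    simp only [Finset.mem_filter, Finset.mem_univ, true_and] at hσ ⊢
    exact K.mul_mem (K.inv_mem hτ) hσ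
  · intros; simp
  · intros; simp
  · intros; simp [MonoidAlgebra.single_mul_single]

theorem twistedSum_mul_single {τ : G} (hτ : τ ∈ K) :
    twistedSum χ K * MonoidAlgebra.single τ (χ τ) = twistedSum χ K := by
  classical
  unfold twistedSum
  rw [Finset.sum_mul]
  refine Finset.sum_bij' (fun σ _ => σ * τ) (fun σ _ => σ * τ⁻¹) ?_ ?_ ?_ ?_ ?_
  · intro σ hσ
    simp only [Finset.mem_filter, Finset.mem_univ, true_and] at hσ ⊢
    exact K.mul_mem hσ hτ
  · intro σ hσ
    simp only [Finset.mem_filter, Finset.mem_univ, true_and] at hσ ⊢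
    exact K.mul_mem hσ (K.inv_mem hτ)
  · intros; simp
  · intros; simp
  · intros; simp [MonoidAlgebra.single_mul_single]

open Classical in
theorem twistedSum_mul_of_le (h : K ≤ L) :
    twistedSum χ K * twistedSum χ L = (Fintype.card K : ℂ) • twistedSum χ L := by
  conv_lhs => rw [twistedSum, Finset.sum_mul]
  rw [Finset.sum_congr rfl (g := fun _ => twistedSum χ L), Finset.sum_const,
    ← Fintype.card_subtype, ← Nat.cast_smul_eq_nsmul ℂ]
  · intro σ hσ
    simp only [Finset.mem_filter, Finset.mem_univ, true_and] at hσ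
    exact single_mul_twistedSum χ (h hσ)

open Classical in
theorem mul_twistedSum_of_le (h : K ≤ L) :
    twistedSum χ L * twistedSum χ K = (Fintype.card K : ℂ) • twistedSum χ L := by
  conv_lhs => rw [twistedSum.eq_def χ K, Finset.mul_sum]
  rw [Finset.sum_congr rfl (g := fun _ => twistedSum χ L), Finset.sum_const,
    ← Fintype.card_subtype, ← Nat.cast_smul_eq_nsmul ℂ]
  · intro σ hσ
    simp only [Finset.mem_filter, Finset.mem_univ, true_and] at hσ
    exact twistedSum_mul_single χ (h hσ)

/-- Conjugation by `τ` carries `L` onto `K`, and `χ` is constant on conjugacy classes because its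
values commute. -/
theorem twistedSum_conj (χ : G →* ℂ) (K L : Subgroup G) (τ : G)
    (h : ∀ σ, σ ∈ L ↔ τ * σ * τ⁻¹ ∈ K) :
    twistedSum χ K * MonoidAlgebra.single τ 1 = MonoidAlgebra.single τ 1 * twistedSum χ L := by
  classical
  unfold twistedSum
  rw [Finset.sum_mul, Finset.mul_sum]
  refine Finset.sum_bij' (fun σ _ => τ⁻¹ * σ * τ) (fun σ _ => τ * σ * τ⁻¹) ?_ ?_ ?_ ?_ ?_
  · intro σ hσ
    simp only [Finset.mem_filter, Finset.mem_univ, true_and] at hσ ⊢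
    rw [h]
    simpa [mul_assoc] using hσ
  · intro σ hσ
    simp only [Finset.mem_filter, Finset.mem_univ, true_and] at hσ ⊢
    rwa [h] at hσ
  · intros; simp [mul_assoc]
  · intros; simp [mul_assoc]
  · intro σ hσ
    simp only [MonoidAlgebra.single_mul_single, mul_one, one_mul, mul_assoc,
      mul_inv_cancel_left]
    congr 1
    rw [map_mul, map_mul, mul_comm (χ σ), ← mul_assoc, mul_comm (χ τ⁻¹), char_mul_inv, one_mul]

end TwistedSums

/-! ### Specht modules in terms of endpoint functions. -/

section EdgeFunctions

variable {n : ℕ} {α α' β β' : Type*}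

/-- The permutations that preserve a function on the edges. -/
def fiberStabilizer (x : Fin n → α) : Subgroup (Equiv.Perm (Fin n)) where
  carrier := {σ | ∀ i, x (σ i) = x i}
  mul_mem' := fun {a b} ha hb i => (ha (b i)).trans (hb i)
  one_mem' := fun _ => rfl
  inv_mem' := fun {a} ha i => by
    have h := ha (a⁻¹ i)
    rw [← Equiv.Perm.mul_apply, mul_inv_cancel, Equiv.Perm.one_apply] at h
    exact h.symm

theorem mem_fiberStabilizer {x : Fin n → α} {σ : Equiv.Perm (Fin n)} :
    σ ∈ fiberStabilizer x ↔ ∀ i, x (σ i) = x i := Iff.rfl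

theorem fiberStabilizer_congr {x : Fin n → α} {x' : Fin n → α'}
    (h : ∀ i j, x i = x j ↔ x' i = x' j) : fiberStabilizer x = fiberStabilizer x' := by
  ext σ
  exact forall_congr' fun i => h _ _

theorem mem_fiberStabilizer_comp (z : Fin n → α) (τ σ : Equiv.Perm (Fin n)) :
    σ ∈ fiberStabilizer (z ∘ τ) ↔ τ * σ * τ⁻¹ ∈ fiberStabilizer z := by
  simp only [mem_fiberStabilizer, Function.comp_apply, Equiv.Perm.mul_apply]
  exact ⟨fun h i => by simpa using h (τ⁻¹ i), fun h i => by simpa using h (τ i)⟩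

/-- The sign character with complex values. -/
noncomputable def signChar (n : ℕ) : Equiv.Perm (Fin n) →* ℂ :=
  ((Int.castRingHom ℂ : ℤ →+* ℂ) : ℤ →* ℂ).comp ((Units.coeHom ℤ).comp Equiv.Perm.sign)

theorem signChar_apply (σ : Equiv.Perm (Fin n)) :
    signChar n σ = ((Equiv.Perm.sign σ : ℤˣ) : ℤ) := rfl

/-- The row sum of a bipartite multigraph in terms of the white endpoints of its edges. -/
noncomputable def symSum (x : Fin n → α) : MonoidAlgebra ℂ (Equiv.Perm (Fin n)) :=
  twistedSum 1 (fiberStabilizer x)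

/-- The column sum of a bipartite multigraph in terms of the black endpoints of its edges. -/
noncomputable def altSum (y : Fin n → β) : MonoidAlgebra ℂ (Equiv.Perm (Fin n)) :=
  twistedSum (signChar n) (fiberStabilizer y)

/-- The Specht module of the bipartite multigraph whose edge `i` joins the white vertex `x i` and
the black vertex `y i`. -/
noncomputable def edgeSpecht (x : Fin n → α) (y : Fin n → β) :
    Ideal (MonoidAlgebra ℂ (Equiv.Perm (Fin n))) :=
  Ideal.span {altSum y * symSum x}

theorem spechtModule_eq_edgeSpecht {D : Set (α × β)} (e : Fin n ≃ D) :
    spechtModule e = edgeSpecht (fun i => (e i).1.1) (fun i => (e i).1.2) := rfl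

/-- Only the partitions of the edges by endpoint matter, so vertices may be renamed freely, even
into another type. -/
theorem edgeSpecht_congr {x : Fin n → α} {y : Fin n → β} {x' : Fin n → α'} {y' : Fin n → β'}
    (hx : ∀ i j, x i = x j ↔ x' i = x' j) (hy : ∀ i j, y i = y j ↔ y' i = y' j) :
    edgeSpecht x y = edgeSpecht x' y' := by
  unfold edgeSpecht altSum symSum
  rw [fiberStabilizer_congr hx, fiberStabilizer_congr hy]

/-- Right multiplication by an element of a ring, as a map of left modules. -/
def rightMul {A : Type*} [Ring A] (a : A) : A →ₗ[A] A := LinearMap.toSpanSingleton A A a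

theorem rightMul_apply {A : Type*} [Ring A] (a b : A) : rightMul a b = b * a := rfl

theorem map_rightMul_span {A : Type*} [Ring A] (a b : A) :
    Submodule.map (rightMul a) (Ideal.span {b}) = Ideal.span {b * a} := by
  unfold Ideal.span
  rw [Submodule.map_span, Set.image_singleton]
  rfl

theorem span_smul_singleton {A : Type*} [Ring A] [Algebra ℂ A] (a : A) {c : ℂ} (hc : c ≠ 0) :
    Ideal.span {c • a} = Ideal.span {a} := by
  apply le_antisymm
  · rw [Ideal.span_singleton_le_iff_mem, Algebra.smul_def]
    exact Ideal.mul_mem_left _ _ (Ideal.mem_span_singleton_self a)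
  · rw [Ideal.span_singleton_le_iff_mem]
    have : a = algebraMap ℂ A c⁻¹ * (c • a) := by
      rw [← Algebra.smul_def, smul_smul, inv_mul_cancel₀ hc, one_smul]
    have h2 := Ideal.mul_mem_left _ (algebraMap ℂ A c⁻¹)
      (Ideal.mem_span_singleton_self (c • a))
    rwa [← this] at h2

/-- Reordering the edges does not change the Specht module up to isomorphism. -/
theorem nonempty_edgeSpecht_reorder (x : Fin n → α) (y : Fin n → β) (τ : Equiv.Perm (Fin n)) :
    Nonempty (edgeSpecht (x ∘ τ) (y ∘ τ) ≃ₗ[MonoidAlgebra ℂ (Equiv.Perm (Fin n))]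
      edgeSpecht x y) := by
  have hu : ∀ σ : Equiv.Perm (Fin n), Function.Injective
      (rightMul (MonoidAlgebra.single σ (1 : ℂ))) := by
    intro σ a b h
    have := congrArg (· * MonoidAlgebra.single σ⁻¹ (1 : ℂ)) h
    simpa [rightMul_apply, mul_assoc, MonoidAlgebra.single_mul_single,
      ← MonoidAlgebra.one_def] using this
  -- Moving `τ` leftwards through both sums turns the generator into `τ` times the reordered
  -- generator, and `τ` is a unit.
  have hmap : Submodule.map (rightMul (MonoidAlgebra.single τ (1 : ℂ))) (edgeSpecht x y) =
      edgeSpecht (x ∘ τ) (y ∘ τ) := by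
    unfold edgeSpecht
    rw [map_rightMul_span]
    unfold symSum altSum
    rw [mul_assoc, twistedSum_conj 1 _ _ τ (mem_fiberStabilizer_comp x τ), ← mul_assoc,
      twistedSum_conj (signChar n) _ _ τ (mem_fiberStabilizer_comp y τ), mul_assoc]
    apply le_antisymm
    · rw [Ideal.span_singleton_le_iff_mem]
      exact Ideal.mul_mem_left _ _ (Ideal.mem_span_singleton_self _)
    · rw [Ideal.span_singleton_le_iff_mem]
      have h1 : ∀ a : MonoidAlgebra ℂ (Equiv.Perm (Fin n)),
          a = MonoidAlgebra.single τ⁻¹ (1 : ℂ) * (MonoidAlgebra.single τ 1 * a) := by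
        intro a
        rw [← mul_assoc, MonoidAlgebra.single_mul_single]
        simp [← MonoidAlgebra.one_def]
      conv => enter [2]; rw [h1 (twistedSum (signChar n) _ * _)]
      exact Ideal.mul_mem_left _ _ (Ideal.mem_span_singleton_self _)
  exact ⟨((Submodule.equivMapOfInjective _ (hu τ) _).trans (LinearEquiv.ofEq _ _ hmap)).symm⟩

end EdgeFunctions

/-! ### Splitting left ideals of a semisimple algebra. -/

section Semisimple

variable {A : Type*} [Ring A] [IsSemisimpleRing A]

theorem nonempty_linearEquiv_map_prod_inf_ker (I : Ideal A) (ρ : A →ₗ[A] A) :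
    Nonempty (I ≃ₗ[A] Submodule.map ρ I × (I ⊓ LinearMap.ker ρ : Submodule A A)) := by
  set f : I →ₗ[A] A := ρ.domRestrict I with hf
  obtain ⟨q, hq⟩ := exists_isCompl (LinearMap.ker f)
  have e1 : I ≃ₗ[A] (LinearMap.ker f) × q := (Submodule.prodEquivOfIsCompl _ _ hq).symm
  have e2 : q ≃ₗ[A] LinearMap.range f :=
    (Submodule.quotientEquivOfIsCompl _ _ hq).symm.trans f.quotKerEquivRange
  have hr : LinearMap.range f = Submodule.map ρ I := by
    rw [hf, LinearMap.range_domRestrict]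
  have hk : Submodule.map I.subtype (LinearMap.ker f) = I ⊓ LinearMap.ker ρ := by
    rw [hf, LinearMap.domRestrict, LinearMap.ker_comp, Submodule.map_comap_subtype]
  have e3 : LinearMap.ker f ≃ₗ[A] (I ⊓ LinearMap.ker ρ : Submodule A A) :=
    (Submodule.equivSubtypeMap I (LinearMap.ker f)).trans (LinearEquiv.ofEq _ _ hk)
  exact ⟨e1.trans ((LinearEquiv.prodComm A _ _).trans
    (LinearEquiv.prodCongr (e2.trans (LinearEquiv.ofEq _ _ hr)) e3))⟩

theorem finrank_map_add_le [Algebra ℂ A] [FiniteDimensional ℂ A] {I K : Ideal A}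
    {ρ : A →ₗ[A] A} (hI : K ≤ I)
    (hK : K ≤ LinearMap.ker ρ) :
    Module.finrank ℂ (Submodule.map ρ I) + Module.finrank ℂ K ≤ Module.finrank ℂ I := by
  obtain ⟨e⟩ := nonempty_linearEquiv_map_prod_inf_ker I ρ
  have h := (e.restrictScalars ℂ).finrank_eq
  have : FiniteDimensional ℂ (Submodule.map ρ I) :=
    inferInstanceAs (FiniteDimensional ℂ ((Submodule.map ρ I).restrictScalars ℂ))
  have : FiniteDimensional ℂ (I ⊓ LinearMap.ker ρ : Submodule A A) :=
    inferInstanceAs (FiniteDimensional ℂ ((I ⊓ LinearMap.ker ρ).restrictScalars ℂ))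
  rw [Module.finrank_prod] at h
  rw [h]
  have := Submodule.finrank_mono (R := ℂ) (s := K.restrictScalars ℂ)
    (t := (I ⊓ LinearMap.ker ρ : Submodule A A).restrictScalars ℂ) (le_inf hI hK)
  exact Nat.add_le_add_left this _

/-- The dimension bound leaves no room between `K` and the kernel of `ρ` on `I`, and that kernel has
a complement by semisimplicity. -/
theorem nonempty_linearEquiv_map_prod [Algebra ℂ A] [FiniteDimensional ℂ A] {I K : Ideal A}
    {ρ : A →ₗ[A] A}
    (hI : K ≤ I) (hK : K ≤ LinearMap.ker ρ)
    (hle : Module.finrank ℂ I ≤ Module.finrank ℂ (Submodule.map ρ I) + Module.finrank ℂ K) :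
    Nonempty (I ≃ₗ[A] Submodule.map ρ I × K) := by
  obtain ⟨e⟩ := nonempty_linearEquiv_map_prod_inf_ker I ρ
  have h := (e.restrictScalars ℂ).finrank_eq
  have : FiniteDimensional ℂ (Submodule.map ρ I) :=
    inferInstanceAs (FiniteDimensional ℂ ((Submodule.map ρ I).restrictScalars ℂ))
  have : FiniteDimensional ℂ (I ⊓ LinearMap.ker ρ : Submodule A A) :=
    inferInstanceAs (FiniteDimensional ℂ ((I ⊓ LinearMap.ker ρ).restrictScalars ℂ))
  rw [Module.finrank_prod] at h
  have hle' : Module.finrank ℂ (I ⊓ LinearMap.ker ρ : Submodule A A) ≤ Module.finrank ℂ K := by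
    omega
  have heq := Submodule.eq_of_le_of_finrank_le (K := ℂ) (S₁ := K.restrictScalars ℂ)
    (S₂ := (I ⊓ LinearMap.ker ρ : Submodule A A).restrictScalars ℂ) (le_inf hI hK) hle'
  have heq' : (I ⊓ LinearMap.ker ρ : Submodule A A) = K :=
    (Submodule.restrictScalars_injective ℂ A A heq).symm
  exact ⟨e.trans (LinearEquiv.prodCongr (LinearEquiv.refl A _) (LinearEquiv.ofEq _ _ heq'))⟩

end Semisimple

/-! ### The algebraic half of the leaf recurrence. -/

section LeafRecurrence

variable {n : ℕ} {α β α' β' : Type*}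

theorem swap_mem_fiberStabilizer {z : Fin n → α} {p q : Fin n} (hz : z p = z q) :
    Equiv.swap p q ∈ fiberStabilizer z := by
  intro i
  rw [Equiv.swap_apply_def]
  split_ifs with h1 h2
  · rw [h1, hz]
  · rw [h2, hz]
  · rfl

/-- The transposition of two parallel edges lies in both stabilizers: the column sum absorbs it with
sign -1, the row sum with sign +1. -/
theorem altSum_mul_symSum_eq_zero {x : Fin n → α} {y : Fin n → β} {p q : Fin n} (hpq : p ≠ q)
    (hx : x p = x q) (hy : y p = y q) : altSum y * symSum x = 0 := by
  have h1 := twistedSum_mul_single (signChar n) (swap_mem_fiberStabilizer hy)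
  have h2 := single_mul_twistedSum (1 : _ →* ℂ) (swap_mem_fiberStabilizer hx)
  rw [signChar_apply, Equiv.Perm.sign_swap hpq] at h1
  have h3 : altSum y * MonoidAlgebra.single (Equiv.swap p q) (1 : ℂ) = -altSum y := by
    rw [altSum]
    nth_rewrite 2 [← h1]
    simp [← mul_neg]
  have h4 : altSum y * symSum x = -(altSum y * symSum x) := by
    nth_rewrite 1 [symSum, ← h2]
    rw [← mul_assoc, MonoidHom.one_apply, h3, neg_mul, symSum]
  have h5 : (2 : ℂ) • (altSum y * symSum x) = 0 := by
    rw [two_smul]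
    exact eq_neg_iff_add_eq_zero.mp h4
  exact (smul_eq_zero.mp h5).resolve_left two_ne_zero

/-- The larger column sum absorbs the smaller one up to the order of the smaller group, so it is a
left multiple of it. -/
theorem edgeSpecht_le_of_fiberStabilizer_le {x : Fin n → α} {y : Fin n → β} {y' : Fin n → β'}
    (h : fiberStabilizer y ≤ fiberStabilizer y') : edgeSpecht x y' ≤ edgeSpecht x y := by
  classical
  unfold edgeSpecht
  have hc : ((Fintype.card (fiberStabilizer y) : ℕ) : ℂ) ≠ 0 :=
    Nat.cast_ne_zero.mpr Fintype.card_ne_zero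
  rw [← span_smul_singleton (altSum y' * symSum x) hc, Ideal.span_singleton_le_iff_mem,
    ← smul_mul_assoc]
  have := mul_twistedSum_of_le (signChar n) h
  have h2 := Ideal.mul_mem_left _ (twistedSum (signChar n) (fiberStabilizer y'))
    (Ideal.mem_span_singleton_self (altSum y * symSum x))
  rwa [← mul_assoc, altSum.eq_def y, this] at h2

theorem map_rightMul_symSum_edgeSpecht {x : Fin n → α} {y : Fin n → β} {x' : Fin n → α'}
    (h : fiberStabilizer x ≤ fiberStabilizer x') :
    Submodule.map (rightMul (symSum x')) (edgeSpecht x y) = edgeSpecht x' y := by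
  classical
  have hc : ((Fintype.card (fiberStabilizer x) : ℕ) : ℂ) ≠ 0 :=
    Nat.cast_ne_zero.mpr Fintype.card_ne_zero
  unfold edgeSpecht
  rw [map_rightMul_span, mul_assoc, symSum.eq_def x, symSum, twistedSum_mul_of_le 1 h,
    mul_smul_comm, span_smul_singleton _ hc]

theorem edgeSpecht_le_ker_rightMul {x' : Fin n → α'} {y' : Fin n → β'} {x : Fin n → α}
    {p q : Fin n} (hpq : p ≠ q) (hx : x' p = x' q) (hy : y' p = y' q)
    (h : fiberStabilizer x ≤ fiberStabilizer x') :
    edgeSpecht x y' ≤ LinearMap.ker (rightMul (symSum x')) := by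
  unfold edgeSpecht
  rw [Ideal.span_singleton_le_iff_mem, LinearMap.mem_ker, rightMul_apply, mul_assoc]
  classical
  rw [symSum.eq_def x, symSum, twistedSum_mul_of_le 1 h, mul_smul_comm]
  have := altSum_mul_symSum_eq_zero hpq hx hy
  rw [symSum] at this
  rw [this, smul_zero]

/-- An edge alone in its fibre is fixed by the whole stabilizer, so giving it another endpoint can
only enlarge the stabilizer. -/
theorem fiberStabilizer_le_update [DecidableEq (Fin n)] {z : Fin n → α} {q : Fin n}
    (hq : ∀ i, z i = z q → i = q) (a : α) :
    fiberStabilizer z ≤ fiberStabilizer (Function.update z q a) := by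
  intro σ hσ i
  have hσq : σ q = q := hq _ (hσ q)
  by_cases hi : i = q
  · rw [hi, hσq]
  · have : σ i ≠ q := fun h => hi (σ.injective (h.trans hσq.symm))
    rw [Function.update_of_ne this, Function.update_of_ne hi, hσ i]

/-- The dimension of the Specht module of a bipartite multigraph. -/
noncomputable def spechtDim (x : Fin n → α) (y : Fin n → β) : ℕ :=
  Module.finrank ℂ (edgeSpecht x y)

theorem spechtDim_add_le {x : Fin n → α} {y : Fin n → β} {p q : Fin n} (hpq : p ≠ q)
    (hp : ∀ i, y i = y p → i = p) (hq : ∀ i, x i = x q → i = q) :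
    spechtDim (Function.update x q (x p)) y + spechtDim x (Function.update y p (y q)) ≤
      spechtDim x y := by
  have hx := fiberStabilizer_le_update hq (x p)
  have hy := fiberStabilizer_le_update hp (y q)
  have := finrank_map_add_le (I := edgeSpecht x y) (edgeSpecht_le_of_fiberStabilizer_le hy)
    (edgeSpecht_le_ker_rightMul hpq (by simp [hpq]) (by simp [hpq.symm]) hx)
  rwa [map_rightMul_symSum_edgeSpecht hx] at this

theorem nonempty_edgeSpecht_equiv_prod {x : Fin n → α} {y : Fin n → β} {p q : Fin n}
    (hpq : p ≠ q) (hp : ∀ i, y i = y p → i = p) (hq : ∀ i, x i = x q → i = q)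
    (hle : spechtDim x y ≤
      spechtDim (Function.update x q (x p)) y + spechtDim x (Function.update y p (y q))) :
    Nonempty (edgeSpecht x y ≃ₗ[MonoidAlgebra ℂ (Equiv.Perm (Fin n))]
      edgeSpecht (Function.update x q (x p)) y × edgeSpecht x (Function.update y p (y q))) := by
  have hx := fiberStabilizer_le_update hq (x p)
  have hy := fiberStabilizer_le_update hp (y q)
  have := nonempty_linearEquiv_map_prod (I := edgeSpecht x y)
    (edgeSpecht_le_of_fiberStabilizer_le hy)
    (edgeSpecht_le_ker_rightMul hpq (by simp [hpq]) (by simp [hpq.symm]) hx)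
  rw [map_rightMul_symSum_edgeSpecht hx] at this
  exact this hle

theorem spechtDim_le_factorial (x : Fin n → α) (y : Fin n → β) :
    spechtDim x y ≤ n.factorial := by
  have h : Module.finrank ℂ (MonoidAlgebra ℂ (Equiv.Perm (Fin n))) = n.factorial := by
    rw [show Module.finrank ℂ (MonoidAlgebra ℂ (Equiv.Perm (Fin n))) =
      Module.finrank ℂ (Equiv.Perm (Fin n) →₀ ℂ) from
      (MonoidAlgebra.coeffLinearEquiv ℂ).finrank_eq, Module.finrank_finsupp_self]
    rw [Fintype.card_perm, Fintype.card_fin]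
  rw [← h]
  exact Submodule.finrank_le ((edgeSpecht x y).restrictScalars ℂ)

end LeafRecurrence

/-! ### A triangular dimension bound. -/

section Triangular

/-- Peel off the index `j` of largest `r`: the other subspaces all lie in the kernel of `π j`, so
rank-nullity on the whole sum adds the two contributions. -/
theorem sum_finrank_map_le {ι P Q : Type*} [AddCommGroup P] [Module ℂ P]
    [AddCommGroup Q] [Module ℂ Q] [DecidableEq ι] (N : Finset ι) (r : ι → ℕ)
    (U : ι → Submodule ℂ P) [∀ i, FiniteDimensional ℂ (U i)]
    (π : ι → P →ₗ[ℂ] Q)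
    (h : ∀ i ∈ N, ∀ j ∈ N, i ≠ j → r i ≤ r j → U i ≤ LinearMap.ker (π j)) :
    ∑ i ∈ N, Module.finrank ℂ ((U i).map (π i)) ≤ Module.finrank ℂ (N.sup U : Submodule ℂ P) := by
  induction N using Finset.induction_on_max_value r with
  | empty => simp
  | insert j s hj hmax ih =>
    rw [Finset.sum_insert hj, Finset.sup_insert]
    have ih' := ih fun i hi k hk => h i (Finset.mem_insert_of_mem hi) k (Finset.mem_insert_of_mem hk)
    have hker : s.sup U ≤ LinearMap.ker (π j) := Finset.sup_le fun i hi =>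
      h i (Finset.mem_insert_of_mem hi) j (Finset.mem_insert_self _ _)
        (fun hij => hj (hij ▸ hi)) (hmax i hi)
    have hfin : FiniteDimensional ℂ (s.sup U : Submodule ℂ P) :=
      Submodule.finiteDimensional_finset_sup s U
    set T := U j ⊔ s.sup U with hT
    have hfinT : FiniteDimensional ℂ T := Submodule.finiteDimensional_sup _ _
    have hrn := ((π j).domRestrict T).finrank_range_add_finrank_ker
    rw [LinearMap.range_domRestrict] at hrn
    have h1 : Module.finrank ℂ ((U j).map (π j)) ≤ Module.finrank ℂ (T.map (π j)) :=
      Submodule.finrank_mono (Submodule.map_mono le_sup_left)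
    have h2 : Module.finrank ℂ (s.sup U : Submodule ℂ P) ≤
        Module.finrank ℂ (LinearMap.ker ((π j).domRestrict T)) := by
      have hk : Submodule.map T.subtype (LinearMap.ker ((π j).domRestrict T)) =
          T ⊓ LinearMap.ker (π j) := by
        rw [LinearMap.domRestrict, LinearMap.ker_comp, Submodule.map_comap_subtype]
      rw [(Submodule.equivSubtypeMap T _).finrank_eq, hk]
      exact Submodule.finrank_mono (le_inf le_sup_right hker)
    omega

end Triangular

/-! ### Polytabloids and deletion of edges. -/

section Tabloids

variable {n : ℕ} {α β : Type*}

open Classical in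
/-- The polytabloid of a tableau `t`, as a combination of labellings by white vertices. -/
noncomputable def polytabloid (x : Fin n → α) (y : Fin n → β) (t : Equiv.Perm (Fin n)) :
    (Fin n → α) →₀ ℂ :=
  ∑ γ : Equiv.Perm (Fin n) with γ ∈ fiberStabilizer y, Finsupp.single (x ∘ γ ∘ t) (signChar n γ)

/-- The span of the polytabloids. -/
noncomputable def polytabloidSpan (x : Fin n → α) (y : Fin n → β) :
    Submodule ℂ ((Fin n → α) →₀ ℂ) :=
  Submodule.span ℂ (Set.range (polytabloid x y))

/-- The action of the group algebra on a labelling. -/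
noncomputable def orbitMap (x : Fin n → α) :
    MonoidAlgebra ℂ (Equiv.Perm (Fin n)) →ₗ[ℂ] ((Fin n → α) →₀ ℂ) :=
  (Finsupp.lmapDomain ℂ ℂ fun σ : Equiv.Perm (Fin n) => x ∘ (σ⁻¹ : Equiv.Perm (Fin n))) ∘ₗ
    (MonoidAlgebra.coeffLinearEquiv ℂ).toLinearMap

theorem orbitMap_single (x : Fin n → α) (σ : Equiv.Perm (Fin n)) (c : ℂ) :
    orbitMap x (MonoidAlgebra.single σ c) = Finsupp.single (x ∘ (σ⁻¹ : Equiv.Perm (Fin n))) c := by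
  simp [orbitMap]

theorem signChar_inv (σ : Equiv.Perm (Fin n)) : signChar n σ⁻¹ = signChar n σ := by
  simp [signChar_apply]

theorem orbitMap_single_mul_altSum (x : Fin n → α) (y : Fin n → β) (τ : Equiv.Perm (Fin n)) :
    orbitMap x (MonoidAlgebra.single τ 1 * altSum y) = polytabloid x y τ⁻¹ := by
  classical
  unfold altSum twistedSum polytabloid
  rw [Finset.mul_sum, map_sum]
  refine Finset.sum_bij' (fun σ _ => σ⁻¹) (fun σ _ => σ⁻¹) ?_ ?_ ?_ ?_ ?_
  · intro σ hσ
    simpa using hσ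
  · intro σ hσ
    simpa using hσ
  · intros; simp
  · intros; simp
  · intro σ hσ
    rw [MonoidAlgebra.single_mul_single, orbitMap_single, one_mul, signChar_inv, mul_inv_rev]
    rfl

-- The labelling `x` is invariant under its own stabilizer, so the row sum acts as a nonzero scalar.
-- Hence `orbitMap` of the Specht module still reaches every polytabloid.
open Classical in
theorem orbitMap_mul_symSum (x : Fin n → α) (a : MonoidAlgebra ℂ (Equiv.Perm (Fin n))) :
    orbitMap x (a * symSum x) = (Fintype.card (fiberStabilizer x) : ℂ) • orbitMap x a := by
  induction a using MonoidAlgebra.induction_linear with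
  | zero => simp
  | add a b ha hb => rw [add_mul, map_add, ha, hb, map_add, smul_add]
  | single τ c =>
    unfold symSum twistedSum
    rw [Finset.mul_sum, map_sum,
      Finset.sum_congr rfl (g := fun _ => orbitMap x (MonoidAlgebra.single τ c)),
      Finset.sum_const, ← Fintype.card_subtype, ← Nat.cast_smul_eq_nsmul ℂ]
    intro σ hσ
    have hσ' := (fiberStabilizer x).inv_mem (Finset.mem_filter.mp hσ).2
    rw [MonoidAlgebra.single_mul_single, orbitMap_single, orbitMap_single, MonoidHom.one_apply,
      mul_one, mul_inv_rev]
    congr 1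
    ext i
    exact hσ' _

theorem finrank_polytabloidSpan_le (x : Fin n → α) (y : Fin n → β) :
    Module.finrank ℂ (polytabloidSpan x y) ≤ spechtDim x y := by
  classical
  have hc : ((Fintype.card (fiberStabilizer x) : ℕ) : ℂ) ≠ 0 :=
    Nat.cast_ne_zero.mpr Fintype.card_ne_zero
  have hle : polytabloidSpan x y ≤
      ((edgeSpecht x y).restrictScalars ℂ).map (orbitMap x) := by
    unfold polytabloidSpan
    rw [Submodule.span_le]
    rintro _ ⟨t, rfl⟩
    rw [SetLike.mem_coe, ← Submodule.smul_mem_iff _ hc]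
    refine ⟨MonoidAlgebra.single t⁻¹ 1 * (altSum y * symSum x), ?_, ?_⟩
    · exact Ideal.mul_mem_left _ _ (Ideal.mem_span_singleton_self _)
    · rw [← mul_assoc, orbitMap_mul_symSum, orbitMap_single_mul_altSum, inv_inv]
  exact (Submodule.finrank_mono hle).trans (Submodule.finrank_map_le _ _)

theorem polytabloid_comp (x : Fin n → α) (y : Fin n → β) (s t : Equiv.Perm (Fin n)) :
    polytabloid (x ∘ s) (y ∘ s) t = polytabloid x y (s * t) := by
  classical
  unfold polytabloid
  refine Finset.sum_bij' (fun σ _ => s * σ * s⁻¹) (fun σ _ => s⁻¹ * σ * s) ?_ ?_ ?_ ?_ ?_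
  · intro σ hσ
    simp only [Finset.mem_filter, Finset.mem_univ, true_and] at hσ ⊢
    rwa [mem_fiberStabilizer_comp] at hσ
  · intro σ hσ
    simp only [Finset.mem_filter, Finset.mem_univ, true_and] at hσ ⊢
    rw [mem_fiberStabilizer_comp]
    simpa [mul_assoc] using hσ
  · intros; simp [mul_assoc]
  · intros; simp [mul_assoc]
  · intro σ hσ
    congr 1
    · ext i
      simp
    · rw [map_mul, map_mul, mul_comm (signChar n s), mul_assoc, char_mul_inv, mul_one]

/-- The component of a combination of labellings at the label `a` of the index `0`. -/
noncomputable def headComponent (m : ℕ) (a : α) :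
    ((Fin (m + 1) → α) →₀ ℂ) →ₗ[ℂ] ((Fin m → α) →₀ ℂ) :=
  Finsupp.lcomapDomain (fun g => (Fin.cons a g : Fin (m + 1) → α)) fun _ _ h =>
    (Fin.cons_injective2 h).2

theorem headComponent_single_of_ne {m : ℕ} {a : α} {h : Fin (m + 1) → α} (ha : h 0 ≠ a) (c : ℂ) :
    headComponent m a (Finsupp.single h c) = 0 := by
  classical
  ext g
  simp only [headComponent, Finsupp.lcomapDomain, LinearMap.coe_mk, AddHom.coe_mk,
    Finsupp.comapDomain_apply, Finsupp.single_apply, Finsupp.coe_zero, Pi.zero_apply]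
  rw [if_neg]
  rintro rfl
  exact ha (Fin.cons_zero _ _)

theorem headComponent_single {m : ℕ} (h : Fin (m + 1) → α) (c : ℂ) :
    headComponent m (h 0) (Finsupp.single h c) = Finsupp.single (h ∘ Fin.succ) c := by
  classical
  ext g
  simp only [headComponent, Finsupp.lcomapDomain, LinearMap.coe_mk, AddHom.coe_mk,
    Finsupp.comapDomain_apply, Finsupp.single_apply]
  congr 1
  rw [eq_iff_iff]
  constructor
  · intro hg
    rw [hg]
    ext i
    simp
  · rintro rfl
    ext i
    refine Fin.cases ?_ (fun i => ?_) i <;> simp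

variable {m : ℕ}

/-- Extend a permutation by fixing the index `0`. -/
def fixZero (t : Equiv.Perm (Fin m)) : Equiv.Perm (Fin (m + 1)) :=
  Equiv.Perm.decomposeFin.symm (0, t)

@[simp] theorem fixZero_zero (t : Equiv.Perm (Fin m)) : fixZero t 0 = 0 := by
  simp [fixZero]

@[simp] theorem fixZero_succ (t : Equiv.Perm (Fin m)) (i : Fin m) :
    fixZero t i.succ = (t i).succ := by
  simp [fixZero]

theorem signChar_fixZero (t : Equiv.Perm (Fin m)) : signChar (m + 1) (fixZero t) = signChar m t := by
  simp [fixZero, signChar_apply, Equiv.Perm.decomposeFin.symm_sign]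

theorem exists_fixZero_eq {γ : Equiv.Perm (Fin (m + 1))} (h : γ 0 = 0) : ∃ t, fixZero t = γ := by
  obtain ⟨⟨p, t⟩, rfl⟩ := Equiv.Perm.decomposeFin.symm.surjective γ
  refine ⟨t, ?_⟩
  rw [Equiv.Perm.decomposeFin_symm_apply_zero] at h
  rw [h, fixZero]

theorem fixZero_injective : Function.Injective (fixZero (m := m)) := by
  intro s t h
  have := Equiv.Perm.decomposeFin.symm.injective h
  simpa using this

/-- In every term the label at `0` comes from an edge with the same black endpoint as edge `0`, so
it is `x 0` or has strictly smaller rank. -/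
theorem headComponent_polytabloid_of_ne {x : Fin (m + 1) → α} {y : Fin (m + 1) → β} {r : α → ℕ}
    (hr : ∀ j, j ≠ 0 → y j = y 0 → r (x j) < r (x 0)) (t : Equiv.Perm (Fin m)) {a : α}
    (ha : a ≠ x 0) (hle : r (x 0) ≤ r a) :
    headComponent m a (polytabloid x y (fixZero t)) = 0 := by
  classical
  unfold polytabloid
  rw [map_sum]
  refine Finset.sum_eq_zero fun γ hγ => headComponent_single_of_ne ?_ _
  have hγ' := (Finset.mem_filter.mp hγ).2 0
  simp only [Function.comp_apply, fixZero_zero]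
  rintro rfl
  by_cases h0 : γ 0 = 0
  · exact ha (by rw [h0])
  · exact absurd (hr _ h0 hγ') (not_lt.mpr hle)

/-- Strictness of `r` means that only terms with `γ 0 = 0` carry the label `x 0`; these are the
column permutations of the graph without edge `0`. -/
theorem headComponent_polytabloid {x : Fin (m + 1) → α} {y : Fin (m + 1) → β} {r : α → ℕ}
    (hr : ∀ j, j ≠ 0 → y j = y 0 → r (x j) < r (x 0)) (t : Equiv.Perm (Fin m)) :
    headComponent m (x 0) (polytabloid x y (fixZero t)) =
      polytabloid (x ∘ Fin.succ) (y ∘ Fin.succ) t := by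
  classical
  unfold polytabloid
  rw [map_sum]
  symm
  refine Finset.sum_of_injOn fixZero fixZero_injective.injOn ?_ ?_ ?_
  · intro γ hγ
    simp only [Finset.coe_filter, Finset.mem_univ, true_and, Set.mem_ofPred_eq,
      mem_fiberStabilizer] at hγ ⊢
    intro i
    refine Fin.cases ?_ (fun i => ?_) i
    · simp
    · simpa using hγ i
  · intro γ hγ hγ'
    have hγ0 := (Finset.mem_filter.mp hγ).2
    refine headComponent_single_of_ne ?_ _
    simp only [Function.comp_apply, fixZero_zero]
    intro hx
    by_cases h0 : γ 0 = 0
    · obtain ⟨s, rfl⟩ := exists_fixZero_eq h0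
      apply hγ'
      refine ⟨s, ?_, rfl⟩
      simp only [Finset.coe_filter, Finset.mem_univ, true_and, Set.mem_ofPred_eq,
        mem_fiberStabilizer]
      intro i
      simpa using hγ0 i.succ
    · have := hr _ h0 (hγ0 0)
      rw [hx] at this
      exact lt_irrefl _ this
  · intro γ hγ
    have h : x 0 = (x ∘ fixZero γ ∘ fixZero t) 0 := by simp
    rw [h, headComponent_single, signChar_fixZero]
    congr 1

theorem sum_finrank_polytabloidSpan_le {x : Fin (m + 1) → α} {y : Fin (m + 1) → β}
    {N : Finset (Fin (m + 1))} {r : α → ℕ} (hN : Set.InjOn x N)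
    (hr : ∀ i ∈ N, ∀ j, j ≠ i → y j = y i → r (x j) < r (x i)) :
    ∑ i ∈ N, Module.finrank ℂ (polytabloidSpan (x ∘ i.succAbove) (y ∘ i.succAbove)) ≤
      Module.finrank ℂ (polytabloidSpan x y) := by
  have hs0 : ∀ i : Fin (m + 1), i.cycleRange.symm 0 = i := fun i => by simp
  have hss : ∀ (i : Fin (m + 1)) (j : Fin m), i.cycleRange.symm j.succ = i.succAbove j :=
    fun i j => by simp
  -- Precomposing with `s i` brings edge `i` to position `0` and keeps the order of the others, so
  -- the head lemmas apply to every edge of `N`.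
  set s : Fin (m + 1) → Equiv.Perm (Fin (m + 1)) := fun i => i.cycleRange.symm with hs
  have hr' : ∀ i ∈ N, ∀ j, j ≠ 0 → (y ∘ s i) j = (y ∘ s i) 0 →
      r ((x ∘ s i) j) < r ((x ∘ s i) 0) := by
    intro i hi j hj hy
    simp only [Function.comp_apply, hs, hs0] at hy ⊢
    refine hr i hi _ (fun h => hj ?_) hy
    exact i.cycleRange.symm.injective (h.trans (hs0 i).symm)
  set U : Fin (m + 1) → Submodule ℂ ((Fin (m + 1) → α) →₀ ℂ) := fun i =>
    Submodule.span ℂ (Set.range fun t => polytabloid (x ∘ s i) (y ∘ s i) (fixZero t)) with hU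
  have hUfin : ∀ i, FiniteDimensional ℂ (U i) := fun i =>
    FiniteDimensional.span_of_finite ℂ (Set.finite_range _)
  have hfin : FiniteDimensional ℂ (polytabloidSpan x y) :=
    FiniteDimensional.span_of_finite ℂ (Set.finite_range _)
  have key := sum_finrank_map_le N (fun i => r (x i)) U (fun i => headComponent m (x i)) ?_
  · refine le_trans (le_of_eq ?_) (key.trans (Submodule.finrank_mono ?_))
    · refine Finset.sum_congr rfl fun i hi => ?_
      have : (U i).map (headComponent m (x i)) =
          polytabloidSpan (x ∘ i.succAbove) (y ∘ i.succAbove) := by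
        simp only [hU, polytabloidSpan]
        rw [Submodule.map_span, ← Set.range_comp]
        congr 2
        ext1 t
        have h := headComponent_polytabloid (hr' i hi) t
        have h1 : (x ∘ s i) 0 = x i := by simp only [Function.comp_apply, hs, hs0]
        have h2 : s i ∘ Fin.succ = i.succAbove := funext (hss i)
        rw [h1, Function.comp_assoc, Function.comp_assoc, h2] at h
        exact h
      rw [this]
    · refine Finset.sup_le fun i hi => ?_
      simp only [hU]
      rw [Submodule.span_le]
      rintro _ ⟨t, rfl⟩
      simp only [polytabloid_comp]
      exact Submodule.subset_span ⟨_, rfl⟩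
  · intro i hi j hj hij hle
    simp only [hU]
    rw [Submodule.span_le]
    rintro _ ⟨t, rfl⟩
    have h1 : (x ∘ s i) 0 = x i := by simp only [Function.comp_apply, hs, hs0]
    refine headComponent_polytabloid_of_ne (hr' i hi) t ?_ ?_
    · rw [h1]
      exact fun h => hij (hN hi hj h.symm)
    · rw [h1]
      exact hle

end Tabloids

/-! ### Combinatorics of forests as edge sets. -/

section Forests

variable {ι κ α β α' β' : Type*}

/-- A bipartite multigraph, given by the white and black endpoints of its edges, is a forest if
every nonempty set of edges contains a leaf edge. -/
def EdgeForest (x : ι → α) (y : ι → β) : Prop :=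
  ∀ F : Finset ι, F.Nonempty →
    ∃ i ∈ F, (∀ j ∈ F, x j = x i → j = i) ∨ (∀ j ∈ F, y j = y i → j = i)

namespace EdgeForest

theorem symm {x : ι → α} {y : ι → β} (h : EdgeForest x y) : EdgeForest y x := by
  intro F hF
  obtain ⟨i, hi, hi'⟩ := h F hF
  exact ⟨i, hi, hi'.symm⟩

theorem comp {x : ι → α} {y : ι → β} (h : EdgeForest x y) {f : κ → ι}
    (hf : Function.Injective f) : EdgeForest (x ∘ f) (y ∘ f) := by
  classical
  intro F hF
  obtain ⟨i, hi, hi'⟩ := h (F.image f) (hF.image f)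
  obtain ⟨k, hk, rfl⟩ := Finset.mem_image.mp hi
  refine ⟨k, hk, hi'.imp ?_ ?_⟩ <;>
  · intro h j hj hjk
    exact hf (h _ (Finset.mem_image_of_mem f hj) hjk)

theorem of_refine {x : ι → α} {y : ι → β} {x' : ι → α'} {y' : ι → β'} (h : EdgeForest x y)
    (hx : ∀ i j, x' i = x' j → x i = x j) (hy : ∀ i j, y' i = y' j → y i = y j) :
    EdgeForest x' y' := by
  intro F hF
  obtain ⟨i, hi, hi'⟩ := h F hF
  exact ⟨i, hi, hi'.imp (fun h j hj hji => h j hj (hx _ _ hji))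
    (fun h j hj hji => h j hj (hy _ _ hji))⟩

/-- The edges of a forest contain a matching that covers every vertex of degree at least two and
meets every edge, compatibly with an order of the white vertices. -/
theorem exists_matching {x : ι → α} {y : ι → β} (h : EdgeForest x y) (F : Finset ι) :
    ∃ N ⊆ F, ∃ r : α → ℕ, Set.InjOn x N ∧ Set.InjOn y N ∧
      (∀ i ∈ F, ∃ k ∈ N, x k = x i ∨ y k = y i) ∧
      (∀ i ∈ F, (∃ k ∈ N, x k = x i) ∨ ∀ j ∈ F, x j = x i → j = i) ∧
      (∀ i ∈ F, (∃ k ∈ N, y k = y i) ∨ ∀ j ∈ F, y j = y i → j = i) ∧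
      (∀ i ∈ N, ∀ j ∈ F, j ≠ i → y j = y i → r (x j) < r (x i)) := by
  classical
  induction F using Finset.strongInduction with
  | H F ih =>
    rcases F.eq_empty_or_nonempty with rfl | hF
    · exact ⟨∅, by simp, fun _ => 0, by simp⟩
    obtain ⟨a, ha, hleaf⟩ := h F hF
    obtain ⟨N, hNF, r, hx, hy, hc, hcx, hcy, hr⟩ := ih _ (Finset.erase_ssubset ha)
    have hsub : ∀ i ∈ N, i ∈ F ∧ i ≠ a := fun i hi =>
      ⟨Finset.mem_of_mem_erase (hNF hi), Finset.ne_of_mem_erase (hNF hi)⟩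
    simp only [Finset.mem_erase] at hc hcx hcy hr
    rcases hleaf with hleaf | hleaf
    · by_cases hcov : ∃ k ∈ N, y k = y a
      -- The white leaf `x a` joins the column of a matching edge, so it must rank below everything
      -- there: it gets 0 and all other ranks move up.
      · refine ⟨N, fun i hi => (hsub i hi).1, fun v => if v = x a then 0 else r v + 1, hx, hy,
          ?_, ?_, ?_, ?_⟩
        · intro i hi
          by_cases hia : i = a
          · grind
          · exact hc i ⟨hia, hi⟩
        · intro i hi
          by_cases hia : i = a
          · subst hia; exact Or.inr hleaf
          · refine (hcx i ⟨hia, hi⟩).imp id fun h j hj hji => ?_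
            by_cases hja : j = a
            · grind
            · exact h j ⟨hja, hj⟩ hji
        · intro i hi
          by_cases hia : i = a
          · subst hia; exact Or.inl hcov
          · by_cases hya : y i = y a
            · rw [hya]; exact Or.inl hcov
            · grind
        · intro i hi j hj hji hyji
          have hxi : x i ≠ x a := fun h => (hsub i hi).2 (hleaf i (hsub i hi).1 h)
          by_cases hja : j = a
          · subst hja; simp [hxi]
          · have hxj : x j ≠ x a := fun h => hja (hleaf j hj h)
            simp only [hxi, hxj, if_false]
            have := hr i hi j ⟨hja, hj⟩ hji hyji
            omega
      · have hcov' : ∀ k ∈ N, y k ≠ y a := fun k hk h => hcov ⟨k, hk, h⟩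
        have hxa : ∀ k ∈ N, x k ≠ x a := fun k hk h =>
          (hsub k hk).2 (hleaf k (hsub k hk).1 h)
        -- Now `a` is itself the matching edge of its column, so `x a` must outrank all white
        -- endpoints in `F`.
        refine ⟨insert a N, ?_, fun v => if v = x a then (F.sup fun j => r (x j)) + 1 else r v,
          ?_, ?_, ?_, ?_, ?_, ?_⟩
        · intro i hi
          rcases Finset.mem_insert.mp hi with rfl | hi
          · exact ha
          · exact (hsub i hi).1
        · rw [Finset.coe_insert, Set.injOn_insert (fun h => (hsub a h).2 rfl)]
          exact ⟨hx, fun ⟨k, hk, h⟩ => hxa k hk h⟩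
        · rw [Finset.coe_insert, Set.injOn_insert (fun h => (hsub a h).2 rfl)]
          exact ⟨hy, fun ⟨k, hk, h⟩ => hcov' k hk h⟩
        · grind
        · grind
        · grind
        · intro i hi j hj hji hyji
          rcases Finset.mem_insert.mp hi with rfl | hi
          · have hxj : x j ≠ x i := fun h => hji (hleaf j hj h)
            simp only [hxj, if_false, if_true]
            exact Nat.lt_succ_of_le (Finset.le_sup (f := fun j => r (x j)) hj)
          · have hja : j ≠ a := fun h => hcov' i hi (by rw [← hyji, h])
            have hxj : x j ≠ x a := fun h => hja (hleaf j hj h)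
            simp only [hxj, hxa i hi, if_false]
            exact hr i hi j ⟨hja, hj⟩ hji hyji
    · have hya : ∀ k ∈ N, y k ≠ y a := fun k hk h =>
        (hsub k hk).2 (hleaf k (hsub k hk).1 h)
      by_cases hcov : ∃ k ∈ N, x k = x a
      · refine ⟨N, fun i hi => (hsub i hi).1, r, hx, hy, ?_, ?_, ?_, ?_⟩
        · grind
        · grind
        · grind
        · intro i hi j hj hji hyji
          have hja : j ≠ a := fun h => hya i hi (by rw [← hyji, h])
          exact hr i hi j ⟨hja, hj⟩ hji hyji
      · have hcov' : ∀ k ∈ N, x k ≠ x a := fun k hk h => hcov ⟨k, hk, h⟩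
        -- A black leaf edge is alone in its column, so the old ranks still serve.
        refine ⟨insert a N, ?_, r, ?_, ?_, ?_, ?_, ?_, ?_⟩
        · intro i hi
          rcases Finset.mem_insert.mp hi with rfl | hi
          · exact ha
          · exact (hsub i hi).1
        · rw [Finset.coe_insert, Set.injOn_insert (fun h => (hsub a h).2 rfl)]
          exact ⟨hx, fun ⟨k, hk, h⟩ => hcov' k hk h⟩
        · rw [Finset.coe_insert, Set.injOn_insert (fun h => (hsub a h).2 rfl)]
          exact ⟨hy, fun ⟨k, hk, h⟩ => hya k hk h⟩
        · grind
        · grind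
        · grind
        · intro i hi j hj hji hyji
          rcases Finset.mem_insert.mp hi with rfl | hi
          · exact absurd (hleaf j hj hyji) hji
          · have hja : j ≠ a := fun h => hya i hi (by rw [← hyji, h])
            exact hr i hi j ⟨hja, hj⟩ hji hyji

/-- Apply the forest condition to the edges that meet another edge. A leaf edge of that set is a
leaf edge of the whole graph, since whatever shares an endpoint with it is in the set too. -/
theorem exists_leaf_edge_of_not_matching [Fintype ι] {x : ι → α} {y : ι → β}
    (h : EdgeForest x y) (hxy : ¬ (Function.Injective x ∧ Function.Injective y)) :
    ∃ a c, a ≠ c ∧ (((∀ j, y j = y a → j = a) ∧ x c = x a) ∨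
      ((∀ j, x j = x a → j = a) ∧ y c = y a)) := by
  classical
  set F : Finset ι := Finset.univ.filter fun i => ∃ j, j ≠ i ∧ (x j = x i ∨ y j = y i) with hF
  have hmem : ∀ i, i ∈ F ↔ ∃ j, j ≠ i ∧ (x j = x i ∨ y j = y i) := fun i => by simp [hF]
  have hne : F.Nonempty := by
    by_contra hemp
    rw [Finset.not_nonempty_iff_eq_empty] at hemp
    apply hxy
    constructor
    · intro i j hij
      by_contra hne
      have : j ∈ F := (hmem j).mpr ⟨i, hne, Or.inl hij⟩
      simp [hemp] at this
    · intro i j hij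
      by_contra hne
      have : j ∈ F := (hmem j).mpr ⟨i, hne, Or.inr hij⟩
      simp [hemp] at this
  obtain ⟨a, ha, hleaf⟩ := h F hne
  obtain ⟨c, hca, hc⟩ := (hmem a).mp ha
  rcases hleaf with hleaf | hleaf
  · have hu : ∀ j, x j = x a → j = a := by
      intro j hj
      by_contra hja
      exact hja (hleaf j ((hmem j).mpr ⟨a, Ne.symm hja, Or.inl hj.symm⟩) hj)
    exact ⟨a, c, hca.symm, Or.inr ⟨hu, hc.resolve_left fun h => hca (hu c h)⟩⟩
  · have hu : ∀ j, y j = y a → j = a := by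
      intro j hj
      by_contra hja
      exact hja (hleaf j ((hmem j).mpr ⟨a, Ne.symm hja, Or.inr hj.symm⟩) hj)
    exact ⟨a, c, hca.symm, Or.inl ⟨hu, hc.resolve_right fun h => hca (hu c h)⟩⟩

theorem update_left [DecidableEq ι] {x : ι → α} {y : ι → β} (h : EdgeForest x y) {c : ι} {v : α}
    (hv : ∀ i, x i ≠ v) : EdgeForest (Function.update x c v) y := by
  refine h.of_refine (fun i j hij => ?_) fun _ _ => id
  by_cases hi : i = c <;> by_cases hj : j = c
  · rw [hi, hj]
  · subst hi; rw [Function.update_self, Function.update_of_ne hj] at hij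
    exact absurd hij.symm (hv j)
  · subst hj; rw [Function.update_self, Function.update_of_ne hi] at hij
    exact absurd hij (hv i)
  · rwa [Function.update_of_ne hi, Function.update_of_ne hj] at hij

/-- Sliding the leaf edge `a` along the edge `c` and detaching `c` keeps a forest a forest. -/
theorem slide [DecidableEq ι] {x : ι → α} {y : ι → β} (h : EdgeForest x y) {a c : ι} {v : α}
    (hac : a ≠ c) (hx : x c = x a) (hv : ∀ i, x i ≠ v) :
    EdgeForest (Function.update x c v) (Function.update y a (y c)) := by
  intro F hF
  by_cases hcF : c ∈ F
  · refine ⟨c, hcF, Or.inl fun j hj hjc => ?_⟩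
    by_contra hne
    rw [Function.update_self, Function.update_of_ne hne] at hjc
    exact hv j hjc
  by_cases haF : a ∈ F
  -- After the slide `a` has the old endpoints of `c`, so `F` has the shape of the old edge set with
  -- `a` replaced by `c`.
  · obtain ⟨e, he, hleaf⟩ := h (insert c (F.erase a)) (Finset.insert_nonempty _ _)
    have hupx : ∀ j ∈ F, Function.update x c v j = x j := fun j hj =>
      Function.update_of_ne (ne_of_mem_of_not_mem hj hcF) _ _
    by_cases hec : e = c
    · subst hec
      refine ⟨a, haF, hleaf.imp (fun hl j hj hja => ?_) (fun hl j hj hja => ?_)⟩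
      · rw [hupx j hj, hupx a haF] at hja
        by_contra hne
        exact hcF (hl j (Finset.mem_insert_of_mem (Finset.mem_erase.mpr ⟨hne, hj⟩))
          (hja.trans hx.symm) ▸ hj)
      · by_contra hne
        rw [Function.update_self, Function.update_of_ne hne] at hja
        exact hcF (hl j (Finset.mem_insert_of_mem (Finset.mem_erase.mpr ⟨hne, hj⟩)) hja ▸ hj)
    · have heF := Finset.mem_erase.mp (Finset.mem_of_mem_insert_of_ne he hec)
      refine ⟨e, heF.2, hleaf.imp (fun hl j hj hje => ?_) (fun hl j hj hje => ?_)⟩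
      · rw [hupx j hj, hupx e heF.2] at hje
        by_cases hja : j = a
        · subst hja
          exact absurd (hl c (Finset.mem_insert_self _ _) (hx.trans hje)).symm hec
        · exact hl j (Finset.mem_insert_of_mem (Finset.mem_erase.mpr ⟨hja, hj⟩)) hje
      · rw [Function.update_of_ne heF.1] at hje
        by_cases hja : j = a
        · subst hja
          rw [Function.update_self] at hje
          exact absurd (hl c (Finset.mem_insert_self _ _) hje).symm hec
        · rw [Function.update_of_ne hja] at hje
          exact hl j (Finset.mem_insert_of_mem (Finset.mem_erase.mpr ⟨hja, hj⟩)) hje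
  · obtain ⟨e, he, hleaf⟩ := h F hF
    have h1 : ∀ j ∈ F, Function.update x c v j = x j := fun j hj =>
      Function.update_of_ne (ne_of_mem_of_not_mem hj hcF) _ _
    have h2 : ∀ j ∈ F, Function.update y a (y c) j = y j := fun j hj =>
      Function.update_of_ne (ne_of_mem_of_not_mem hj haF) _ _
    refine ⟨e, he, hleaf.imp (fun hl j hj hje => ?_) (fun hl j hj hje => ?_)⟩
    · exact hl j hj (by rwa [h1 j hj, h1 e he] at hje)
    · exact hl j hj (by rwa [h2 j hj, h2 e he] at hje)

end EdgeForest

end Forests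

/-! ### Volumes of matching polytopes: shearing and coning. -/

section MatchingPolytope

open MeasureTheory

variable {n m : ℕ} {α β : Type*}

open Classical in
/-- The matching polytope of a bipartite multigraph. -/
def matchingPolytope (x : Fin n → α) (y : Fin n → β) : Set (Fin n → ℝ) :=
  {z | (∀ i, 0 ≤ z i) ∧ (∀ j, ∑ i with x i = x j, z i ≤ 1) ∧ ∀ j, ∑ i with y i = y j, z i ≤ 1}

theorem matchingPolytope_symm (x : Fin n → α) (y : Fin n → β) :
    matchingPolytope x y = matchingPolytope y x := by
  ext z
  simp only [matchingPolytope, Set.mem_ofPred_eq]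
  tauto

theorem le_one_of_mem_matchingPolytope {x : Fin n → α} {y : Fin n → β} {z : Fin n → ℝ}
    (hz : z ∈ matchingPolytope x y) (i : Fin n) : z i ≤ 1 := by
  classical
  refine le_trans ?_ (hz.2.1 i)
  exact Finset.single_le_sum (f := z) (fun j _ => hz.1 j) (by simp)

theorem volume_inter_le_slide {x : Fin n → α} {y : Fin n → β} {p q : Fin n} (hpq : p ≠ q)
    (hp : ∀ i, y i = y p → i = p) :
    volume (matchingPolytope x y ∩ {z | z p ≤ z q}) ≤
      volume (matchingPolytope x (Function.update y p (y q))) := by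
  classical
  -- `T` adds z_p to z_q. Its inverse sends the half z_p ≤ z_q into the new polytope: at the black
  -- vertex `y q` the new term z_p is offset by z_q - z_p, and elsewhere no sum grows.
  set T : (Fin n → ℝ) →ₗ[ℝ] (Fin n → ℝ) :=
    LinearMap.transvection (LinearMap.proj p) (Pi.single q 1) with hT
  have hdet : LinearMap.det T = 1 := by
    rw [hT, LinearMap.transvection.det]
    simp [hpq]
  have hvol := Measure.addHaar_image_linearMap volume T
    (matchingPolytope x (Function.update y p (y q)))
  rw [hdet, abs_one, ENNReal.ofReal_one, one_mul] at hvol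
  rw [← hvol]
  refine measure_mono ?_
  rintro z ⟨hz, hzpq⟩
  have hzpq' : z p ≤ z q := hzpq
  set z' : Fin n → ℝ := Function.update z q (z q - z p) with hz'
  have hle : ∀ i, z' i ≤ z i := by
    intro i
    by_cases hi : i = q
    · subst hi
      simp [hz', hz.1 p]
    · simp [hz', hi]
  have hyqp : y q ≠ y p := fun h => hpq (hp q h).symm
  refine ⟨z', ⟨?_, ?_, ?_⟩, ?_⟩
  · intro i
    by_cases hi : i = q
    · subst hi
      simpa [hz'] using hzpq'
    · simpa [hz', hi] using hz.1 i
  · intro j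
    exact (Finset.sum_le_sum fun i _ => hle i).trans (hz.2.1 j)
  · intro j
    by_cases hj : Function.update y p (y q) j = y q
    · have hset : (Finset.univ.filter fun i => Function.update y p (y q) i = y q) =
          insert p (insert q ((Finset.univ.filter fun i => y i = y q).erase q)) := by
        ext i
        simp only [Finset.mem_filter, Finset.mem_univ, true_and, Finset.mem_insert,
          Finset.mem_erase]
        by_cases hi : i = p
        · subst hi; simp
        · rw [Function.update_of_ne hi]
          by_cases hiq : i = q
          · simp [hiq]
          · simp [hi, hiq]
      have hset' : (Finset.univ.filter fun i => y i = y q) =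
          insert q ((Finset.univ.filter fun i => y i = y q).erase q) := by
        rw [Finset.insert_erase (by simp)]
      have h1 := hz.2.2 q
      rw [hset', Finset.sum_insert (Finset.notMem_erase _ _)] at h1
      rw [hj, hset, Finset.sum_insert, Finset.sum_insert (Finset.notMem_erase _ _)]
      · have h2 : z' p = z p := by simp [hz', hpq]
        have h3 : z' q = z q - z p := by simp [hz']
        have h4 : ∑ i ∈ (Finset.univ.filter fun i => y i = y q).erase q, z' i =
            ∑ i ∈ (Finset.univ.filter fun i => y i = y q).erase q, z i :=
          Finset.sum_congr rfl fun i hi => by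
            rw [hz', Function.update_of_ne (Finset.ne_of_mem_erase hi)]
        rw [h2, h3, h4]
        linarith
      · simp [hyqp.symm]
    · have hjp : j ≠ p := by
        rintro rfl
        simp at hj
      rw [Function.update_of_ne hjp]
      rw [Function.update_of_ne hjp] at hj
      refine le_trans ?_ (hz.2.2 j)
      have hset : (Finset.univ.filter fun i => Function.update y p (y q) i = y j) =
          Finset.univ.filter fun i => y i = y j := by
        ext i
        simp only [Finset.mem_filter, Finset.mem_univ, true_and]
        by_cases hi : i = p
        · subst hi
          rw [Function.update_self]
          exact ⟨fun h => absurd h.symm hj, fun h => absurd (hp j h.symm) hjp⟩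
        · rw [Function.update_of_ne hi]
      rw [hset]
      exact Finset.sum_le_sum fun i _ => hle i
  · ext i
    by_cases hi : i = q
    · subst hi
      simp [hT, LinearMap.transvection, hz', hpq]
    · simp [hT, LinearMap.transvection, hz', hi]

theorem volume_matchingPolytope_le_add {x : Fin n → α} {y : Fin n → β} {p q : Fin n}
    (hpq : p ≠ q) (hp : ∀ i, y i = y p → i = p) (hq : ∀ i, x i = x q → i = q) :
    volume (matchingPolytope x y) ≤
      volume (matchingPolytope (Function.update x q (x p)) y) +
        volume (matchingPolytope x (Function.update y p (y q))) := by
  have h1 := volume_inter_le_slide (x := x) hpq hp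
  have h2 := volume_inter_le_slide (x := y) hpq.symm hq
  rw [matchingPolytope_symm y x, matchingPolytope_symm y] at h2
  refine le_trans (measure_mono ?_) ((measure_union_le _ _).trans (add_le_add h2 h1))
  intro z hz
  rcases le_total (z q) (z p) with h | h
  · exact Or.inl ⟨hz, h⟩
  · exact Or.inr ⟨hz, h⟩

theorem isClosed_matchingPolytope (x : Fin n → α) (y : Fin n → β) :
    IsClosed (matchingPolytope x y) := by
  classical
  have : matchingPolytope x y = (⋂ i, {z | 0 ≤ z i}) ∩ ((⋂ j, {z | ∑ i with x i = x j, z i ≤ 1}) ∩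
      ⋂ j, {z | ∑ i with y i = y j, z i ≤ 1}) := by
    ext z
    simp [matchingPolytope]
  rw [this]
  refine IsClosed.inter (isClosed_iInter fun i => ?_) (IsClosed.inter
    (isClosed_iInter fun i => ?_) (isClosed_iInter fun i => ?_))
  · exact isClosed_le (by fun_prop) (by fun_prop)
  · exact isClosed_le (by fun_prop) (by fun_prop)
  · exact isClosed_le (by fun_prop) (by fun_prop)

theorem matchingPolytope_of_injective {x : Fin n → α} {y : Fin n → β}
    (hx : Function.Injective x) (hy : Function.Injective y) :
    matchingPolytope x y = Set.Icc 0 1 := by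
  classical
  ext z
  simp only [matchingPolytope, Set.mem_ofPred_eq, hx.eq_iff, hy.eq_iff, Set.mem_Icc, Pi.le_def,
    Finset.sum_filter, Finset.sum_ite_eq', Finset.mem_univ, if_true, Pi.zero_apply, Pi.one_apply,
    and_self]

theorem sum_fiber_sub_le {z : Fin n → ℝ} {x : Fin n → α} [DecidableEq α] {N : Finset (Fin n)}
    {s : ℝ} (hs : 0 ≤ s) {j k : Fin n} (hk : k ∈ N) (hkj : x k = x j)
    (hz : ∑ i with x i = x j, z i ≤ 1) :
    ∑ i with x i = x j, (z i - if i ∈ N then s else 0) ≤ 1 - s := by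
  rw [Finset.sum_sub_distrib]
  have := Finset.single_le_sum (s := Finset.univ.filter fun i => x i = x j)
    (f := fun i => if i ∈ N then s else (0 : ℝ)) (fun i _ => by split_ifs <;> simp [hs])
    (show k ∈ _ by simpa using hkj)
  simp only [hk, if_true] at this
  linarith

/-- A vertex covered by `N` loses at least `s`. An uncovered one has the single edge `j`, whose
other end is covered, and the bound there dominates the value on `j`. -/
theorem sum_fiber_sub_le_of_cover {z : Fin n → ℝ} {x : Fin n → α} {y : Fin n → β}
    [DecidableEq α] [DecidableEq β] {N : Finset (Fin n)}
    {s : ℝ} (hs : 0 ≤ s) (hpos : ∀ i, 0 ≤ z i - if i ∈ N then s else 0)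
    (hzx : ∀ j, ∑ i with x i = x j, z i ≤ 1) (hzy : ∀ j, ∑ i with y i = y j, z i ≤ 1)
    (hc : ∀ i, ∃ k ∈ N, x k = x i ∨ y k = y i)
    (hcx : ∀ i, (∃ k ∈ N, x k = x i) ∨ ∀ j, x j = x i → j = i) (j : Fin n) :
    ∑ i with x i = x j, (z i - if i ∈ N then s else 0) ≤ 1 - s := by
  by_cases hcov : ∃ k ∈ N, x k = x j
  · obtain ⟨k, hk, hkj⟩ := hcov
    exact sum_fiber_sub_le hs hk hkj (hzx j)
  · have huniq := (hcx j).resolve_left hcov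
    obtain ⟨k, hk, hkj⟩ := hc j
    have hkj' : y k = y j := hkj.resolve_left fun h => hcov ⟨k, hk, h⟩
    have hset : (Finset.univ.filter fun i => x i = x j) = {j} := by
      ext i
      simp only [Finset.mem_filter, Finset.mem_univ, true_and, Finset.mem_singleton]
      exact ⟨huniq i, fun h => by rw [h]⟩
    rw [hset, Finset.sum_singleton]
    refine le_trans ?_ (sum_fiber_sub_le hs hk hkj' (hzy j))
    exact Finset.single_le_sum (f := fun i => z i - if i ∈ N then s else 0)
      (fun i _ => hpos i) (by simp)

theorem sum_fiber_succAbove {x : Fin (m + 1) → α} [DecidableEq α] {e : Fin (m + 1)}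
    {d : Fin (m + 1) → ℝ} (hd : d e = 0) (a : α) :
    ∑ i with (x ∘ e.succAbove) i = a, d (e.succAbove i) = ∑ i with x i = a, d i := by
  rw [Finset.sum_filter, Finset.sum_filter, Fin.sum_univ_succAbove _ e, hd]
  simp

theorem lintegral_one_sub_pow (m : ℕ) :
    ∫⁻ s in Set.Icc (0 : ℝ) 1, ENNReal.ofReal ((1 - s) ^ m) = ENNReal.ofReal (1 / (m + 1)) := by
  rw [← ofReal_integral_eq_lintegral_ofReal]
  · rw [integral_Icc_eq_integral_Ioc, ← intervalIntegral.integral_of_le zero_le_one,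
      intervalIntegral.integral_comp_sub_left (fun s => s ^ m) 1]
    simp
  · exact (by fun_prop : Continuous fun s : ℝ => (1 - s) ^ m).integrableOn_Icc
  · filter_upwards [ae_restrict_mem measurableSet_Icc] with s hs
    exact pow_nonneg (sub_nonneg.mpr hs.2) m

/-- The part of the matching polytope lying over the facet at the edge `e`, as seen from the
indicator vector of the matching `N`. -/
def matchingCone (x : Fin n → α) (y : Fin n → β) (N : Finset (Fin n)) (e : Fin n) :
    Set (Fin n → ℝ) :=
  {z | z ∈ matchingPolytope x y ∧ ∀ k ∈ N, z e ≤ z k}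

theorem measurableSet_matchingCone (x : Fin n → α) (y : Fin n → β) (N : Finset (Fin n))
    (e : Fin n) : MeasurableSet (matchingCone x y N e) := by
  have : matchingCone x y N e = matchingPolytope x y ∩ ⋂ k ∈ N, {z | z e ≤ z k} := by
    ext z
    simp [matchingCone]
  rw [this]
  exact ((isClosed_matchingPolytope x y).inter (isClosed_biInter fun k _ =>
    isClosed_le (by fun_prop) (by fun_prop))).measurableSet

variable {x : Fin (m + 1) → α} {y : Fin (m + 1) → β} {N : Finset (Fin (m + 1))}

-- With `s` the value at `e`, the minimum over `N`, subtracting `s` times the indicator of `N`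
-- leaves a point of (1 - s) times the polytope without `e`. So the slice lies in a homothetic copy
-- centred at that indicator.
open Classical in
theorem matchingCone_slice_subset (hc : ∀ i, ∃ k ∈ N, x k = x i ∨ y k = y i)
    (hcx : ∀ i, (∃ k ∈ N, x k = x i) ∨ ∀ j, x j = x i → j = i)
    (hcy : ∀ i, (∃ k ∈ N, y k = y i) ∨ ∀ j, y j = y i → j = i) {e : Fin (m + 1)} (he : e ∈ N)
    {s : ℝ} (hs : s < 1) :
    {u | e.insertNth s u ∈ matchingCone x y N e} ⊆
      AffineMap.homothety (fun i => if e.succAbove i ∈ N then 1 else 0 : Fin m → ℝ) (1 - s) ''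
        matchingPolytope (x ∘ e.succAbove) (y ∘ e.succAbove) := by
  rintro u ⟨hz, hmin⟩
  set z : Fin (m + 1) → ℝ := e.insertNth s u with hzdef
  have hze : z e = s := by simp [hzdef]
  have hzu : ∀ i, z (e.succAbove i) = u i := by simp [hzdef]
  have hs0 : 0 ≤ s := hze ▸ hz.1 e
  have hs1 : 0 < 1 - s := sub_pos.mpr hs
  rw [hze] at hmin
  set d : Fin (m + 1) → ℝ := fun i => z i - if i ∈ N then s else 0 with hd
  have hde : d e = 0 := by simp [hd, he, hze]
  have hpos : ∀ i, 0 ≤ d i := by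
    intro i
    by_cases hi : i ∈ N
    · simpa [hd, hi] using hmin i hi
    · simpa [hd, hi] using hz.1 i
  have hdx := sum_fiber_sub_le_of_cover hs0 hpos hz.2.1 hz.2.2 hc hcx
  have hdy := sum_fiber_sub_le_of_cover hs0 hpos hz.2.2 hz.2.1
    (fun i => (hc i).imp fun k hk => ⟨hk.1, hk.2.symm⟩) hcy
  refine ⟨fun i => d (e.succAbove i) / (1 - s), ⟨?_, ?_, ?_⟩, ?_⟩
  · exact fun i => div_nonneg (hpos _) hs1.le
  · intro j
    rw [← Finset.sum_div, sum_fiber_succAbove (x := x) hde, div_le_one hs1]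
    exact hdx _
  · intro j
    rw [← Finset.sum_div, sum_fiber_succAbove (x := y) hde, div_le_one hs1]
    exact hdy _
  · ext i
    rw [AffineMap.homothety_apply]
    simp only [vsub_eq_sub, vadd_eq_add, Pi.add_apply, Pi.smul_apply, Pi.sub_apply, smul_eq_mul,
      hd, hzu]
    split_ifs <;> field_simp <;> ring

/-- Fubini along the coordinate `e`: the slice at height `s` has at most (1 - s)^m times the volume
of the smaller polytope, and this factor integrates to 1/(m + 1). -/
theorem volume_matchingCone_le (hc : ∀ i, ∃ k ∈ N, x k = x i ∨ y k = y i)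
    (hcx : ∀ i, (∃ k ∈ N, x k = x i) ∨ ∀ j, x j = x i → j = i)
    (hcy : ∀ i, (∃ k ∈ N, y k = y i) ∨ ∀ j, y j = y i → j = i) {e : Fin (m + 1)} (he : e ∈ N) :
    volume (matchingCone x y N e) ≤ ENNReal.ofReal (1 / (m + 1)) *
      volume (matchingPolytope (x ∘ e.succAbove) (y ∘ e.succAbove)) := by
  classical
  have hmp := (volume_preserving_piFinSuccAbove (fun _ : Fin (m + 1) => ℝ) e).symm
  have hmeas := measurableSet_matchingCone x y N e
  rw [← hmp.measure_preimage hmeas.nullMeasurableSet, Measure.volume_eq_prod,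
    Measure.prod_apply (hmp.measurable hmeas), ← lintegral_one_sub_pow,
    ← lintegral_mul_const _ (by fun_prop), ← lintegral_indicator measurableSet_Icc]
  refine lintegral_mono_ae ?_
  -- The null set s = 1 is dropped because the slice bound divides by 1 - s.
  filter_upwards [Measure.ae_ne volume (1 : ℝ)] with s hs
  have hpre : Prod.mk s ⁻¹' ((MeasurableEquiv.piFinSuccAbove (fun _ : Fin (m + 1) => ℝ) e).symm ⁻¹'
      matchingCone x y N e) = {u | e.insertNth s u ∈ matchingCone x y N e} := rfl
  rw [hpre]
  by_cases hs01 : s ∈ Set.Icc (0 : ℝ) 1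
  · rw [Set.indicator_of_mem hs01]
    refine (measure_mono (matchingCone_slice_subset hc hcx hcy he
      (lt_of_le_of_ne hs01.2 hs))).trans (le_of_eq ?_)
    rw [Measure.addHaar_image_homothety, Module.finrank_fin_fun,
      abs_of_nonneg (pow_nonneg (sub_nonneg.mpr hs01.2) m)]
  · rw [Set.indicator_of_notMem hs01]
    have : {u | e.insertNth s u ∈ matchingCone x y N e} = ∅ := by
      refine Set.eq_empty_of_forall_notMem fun u hu => hs01 ?_
      have h0 := hu.1.1 e
      have h1 := le_one_of_mem_matchingPolytope hu.1 e
      rw [Fin.insertNth_apply_same] at h0 h1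
      exact ⟨h0, h1⟩
    rw [this, measure_empty]

theorem volume_matchingPolytope_le_sum (hc : ∀ i, ∃ k ∈ N, x k = x i ∨ y k = y i)
    (hcx : ∀ i, (∃ k ∈ N, x k = x i) ∨ ∀ j, x j = x i → j = i)
    (hcy : ∀ i, (∃ k ∈ N, y k = y i) ∨ ∀ j, y j = y i → j = i) :
    ((m + 1).factorial : ENNReal) * volume (matchingPolytope x y) ≤
      ∑ e ∈ N, (m.factorial : ENNReal) *
        volume (matchingPolytope (x ∘ e.succAbove) (y ∘ e.succAbove)) := by
  have hN : N.Nonempty := by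
    obtain ⟨k, hk, -⟩ := hc 0
    exact ⟨k, hk⟩
  have hcover : matchingPolytope x y ⊆ ⋃ e ∈ N, matchingCone x y N e := by
    intro z hz
    -- A point belongs to the cone of an edge of `N` on which it is smallest.
    obtain ⟨e, he, hmin⟩ := N.exists_min_image z hN
    exact Set.mem_biUnion he ⟨hz, hmin⟩
  have hfac : ((m + 1).factorial : ENNReal) * ENNReal.ofReal (1 / (m + 1)) = m.factorial := by
    rw [← ENNReal.ofReal_natCast, ← ENNReal.ofReal_mul (by positivity), Nat.factorial_succ,
      ← ENNReal.ofReal_natCast]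
    congr 1
    push_cast
    field_simp
  calc ((m + 1).factorial : ENNReal) * volume (matchingPolytope x y)
      ≤ ((m + 1).factorial : ENNReal) * ∑ e ∈ N, ENNReal.ofReal (1 / (m + 1)) *
          volume (matchingPolytope (x ∘ e.succAbove) (y ∘ e.succAbove)) := by
        gcongr
        exact (measure_mono hcover).trans ((measure_biUnion_finset_le N _).trans
          (Finset.sum_le_sum fun e he => volume_matchingCone_le hc hcx hcy he))
    _ = _ := by
        rw [Finset.mul_sum]
        exact Finset.sum_congr rfl fun e _ => by rw [← mul_assoc, hfac]

end MatchingPolytope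

/-! ### Dimension equals normalized volume for forests. -/

section DimensionFormula

open MeasureTheory

variable {n : ℕ} {α β : Type*}

/-- The normalized volume of the matching polytope. -/
noncomputable def matchingVolume (x : Fin n → α) (y : Fin n → β) : ENNReal :=
  (n.factorial : ENNReal) * volume (matchingPolytope x y)

theorem matchingVolume_le_add {x : Fin n → α} {y : Fin n → β} {p q : Fin n}
    (hpq : p ≠ q) (hp : ∀ i, y i = y p → i = p) (hq : ∀ i, x i = x q → i = q) :
    matchingVolume x y ≤ matchingVolume (Function.update x q (x p)) y +
      matchingVolume x (Function.update y p (y q)) := by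
  unfold matchingVolume
  rw [← mul_add]
  gcongr
  exact volume_matchingPolytope_le_add hpq hp hq

theorem matchingVolume_of_injective {x : Fin n → α} {y : Fin n → β}
    (hx : Function.Injective x) (hy : Function.Injective y) :
    matchingVolume x y = n.factorial := by
  rw [matchingVolume, matchingPolytope_of_injective hx hy, Real.volume_Icc_pi]
  simp

theorem one_le_finrank_polytabloidSpan_zero (x : Fin 0 → α) (y : Fin 0 → β) :
    1 ≤ Module.finrank ℂ (polytabloidSpan x y) := by
  classical
  have hfin : FiniteDimensional ℂ (polytabloidSpan x y) :=
    FiniteDimensional.span_of_finite ℂ (Set.finite_range _)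
  rw [Nat.one_le_iff_ne_zero, ne_eq, Submodule.finrank_eq_zero, polytabloidSpan,
    Submodule.span_eq_bot]
  intro h
  have h0 := h _ ⟨1, rfl⟩
  have hf : (Finset.univ.filter fun γ : Equiv.Perm (Fin 0) => γ ∈ fiberStabilizer y) = {1} := by
    ext γ
    simp [Subsingleton.elim γ 1, one_mem]
  rw [polytabloid, hf, Finset.sum_singleton, Finsupp.single_eq_zero] at h0
  simp at h0

theorem matchingVolume_le_finrank {n : ℕ} {x : Fin n → α} {y : Fin n → β}
    (h : EdgeForest x y) :
    matchingVolume x y ≤ (Module.finrank ℂ (polytabloidSpan x y) : ENNReal) := by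
  induction n with
  | zero =>
    rw [matchingVolume_of_injective (Function.injective_of_subsingleton x)
      (Function.injective_of_subsingleton y)]
    exact_mod_cast one_le_finrank_polytabloidSpan_zero x y
  | succ m ih =>
    obtain ⟨N, -, r, hx, -, hc, hcx, hcy, hr⟩ := h.exists_matching Finset.univ
    simp only [Finset.mem_univ, true_imp_iff] at hc hcx hcy hr
    calc matchingVolume x y
        ≤ ∑ e ∈ N, matchingVolume (x ∘ e.succAbove) (y ∘ e.succAbove) :=
          volume_matchingPolytope_le_sum hc hcx hcy
      _ ≤ ∑ e ∈ N, (Module.finrank ℂ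
            (polytabloidSpan (x ∘ e.succAbove) (y ∘ e.succAbove)) : ENNReal) :=
          Finset.sum_le_sum fun e _ => ih (h.comp Fin.succAbove_right_injective)
      _ ≤ _ := by exact_mod_cast sum_finrank_polytabloidSpan_le hx hr

theorem matchingVolume_le_spechtDim {x : Fin n → α} {y : Fin n → β} (h : EdgeForest x y) :
    matchingVolume x y ≤ (spechtDim x y : ENNReal) :=
  (matchingVolume_le_finrank h).trans (by exact_mod_cast finrank_polytabloidSpan_le x y)

theorem spechtDim_ne_top (x : Fin n → α) (y : Fin n → β) : (spechtDim x y : ENNReal) ≠ ⊤ :=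
  ENNReal.natCast_ne_top _

/-- The children satisfy dim + dim ≤ dim of the parent ≤ `M` of the parent ≤ `M` + `M`; a forest
sibling has `M` ≤ dim, which is finite and cancels. -/
theorem spechtDim_le_matchingVolume_of_parent {x : Fin n → α} {y : Fin n → β} {p q : Fin n}
    (hpq : p ≠ q) (hp : ∀ i, y i = y p → i = p) (hq : ∀ i, x i = x q → i = q)
    (hG : (spechtDim x y : ENNReal) ≤ matchingVolume x y) :
    (EdgeForest x (Function.update y p (y q)) →
      (spechtDim (Function.update x q (x p)) y : ENNReal) ≤
        matchingVolume (Function.update x q (x p)) y) ∧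
    (EdgeForest (Function.update x q (x p)) y →
      (spechtDim x (Function.update y p (y q)) : ENNReal) ≤
        matchingVolume x (Function.update y p (y q))) := by
  have h1 : (spechtDim (Function.update x q (x p)) y : ENNReal) +
      spechtDim x (Function.update y p (y q)) ≤ spechtDim x y := by
    exact_mod_cast spechtDim_add_le hpq hp hq
  have h2 := (h1.trans hG).trans (matchingVolume_le_add hpq hp hq)
  constructor
  · intro hf
    refine ENNReal.le_of_add_le_add_right (spechtDim_ne_top x (Function.update y p (y q)))
      (h2.trans ?_)
    gcongr
    exact matchingVolume_le_spechtDim hf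
  · intro hf
    refine ENNReal.le_of_add_le_add_left (spechtDim_ne_top (Function.update x q (x p)) y)
      (h2.trans ?_)
    gcongr
    exact matchingVolume_le_spechtDim hf

theorem card_image_lt_card_image_update {ι : Type*} [Fintype ι] [DecidableEq ι] {x : ι → ℕ}
    {a c : ι} {v : ℕ} (hac : a ≠ c) (hx : x c = x a) (hv : ∀ i, x i ≠ v) :
    (Finset.univ.image x).card < (Finset.univ.image (Function.update x c v)).card := by
  refine Finset.card_lt_card ⟨?_, fun h => ?_⟩
  · intro b hb
    obtain ⟨i, -, rfl⟩ := Finset.mem_image.mp hb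
    by_cases hi : i = c
    · exact Finset.mem_image.mpr ⟨a, Finset.mem_univ _, by
        rw [Function.update_of_ne hac, hi, hx]⟩
    · exact Finset.mem_image.mpr ⟨i, Finset.mem_univ _, by rw [Function.update_of_ne hi]⟩
  · have : v ∈ Finset.univ.image (Function.update x c v) :=
      Finset.mem_image.mpr ⟨c, Finset.mem_univ _, Function.update_self _ _ _⟩
    obtain ⟨i, -, hi⟩ := Finset.mem_image.mp (h this)
    exact hv i hi

theorem spechtDim_le_matchingVolume {x y : Fin n → ℕ} (h : EdgeForest x y) :
    (spechtDim x y : ENNReal) ≤ matchingVolume x y := by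
  -- The measure is the number of vertices missing compared with n disjoint edges; each passage to a
  -- parent adds a vertex.
  induction hk : 2 * n - ((Finset.univ.image x).card + (Finset.univ.image y).card)
    using Nat.strong_induction_on generalizing x y with
  | _ k ih =>
  by_cases hxy : Function.Injective x ∧ Function.Injective y
  · rw [matchingVolume_of_injective hxy.1 hxy.2]
    exact_mod_cast spechtDim_le_factorial x y
  have hbound : ∀ z : Fin n → ℕ, (Finset.univ.image z).card ≤ n := fun z =>
    Finset.card_image_le.trans (by simp)
  have hfresh : ∀ z : Fin n → ℕ, ∃ v, ∀ i, z i ≠ v := fun z => by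
    obtain ⟨v, hv⟩ := Infinite.exists_notMem_finset (Finset.univ.image z)
    exact ⟨v, fun i hi => hv (Finset.mem_image.mpr ⟨i, Finset.mem_univ _, hi⟩)⟩
  have hself : ∀ (z : Fin n → ℕ) (a c : Fin n) (v : ℕ), a ≠ c → z c = z a →
      Function.update (Function.update z c v) c (Function.update z c v a) = z := by
    intro z a c v hac hz
    rw [Function.update_of_ne hac, Function.update_idem, ← hz, Function.update_eq_self]
  have huniq : ∀ (z : Fin n → ℕ) (c : Fin n) (v : ℕ), (∀ i, z i ≠ v) →
      ∀ i, Function.update z c v i = Function.update z c v c → i = c := by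
    intro z c v hv i hi
    by_contra hne
    rw [Function.update_self, Function.update_of_ne hne] at hi
    exact hv i hi
  obtain ⟨a, c, hac, ⟨hleaf, hadj⟩ | ⟨hleaf, hadj⟩⟩ := h.exists_leaf_edge_of_not_matching hxy
  -- The parent detaches `c` from the white vertex that it shares with the leaf edge `a`. Its two
  -- children are the given forest, with `c` reattached, and the slide of `a` along `c`.
  · obtain ⟨v, hv⟩ := hfresh x
    have hG := h.update_left (c := c) hv
    have hlt := card_image_lt_card_image_update hac hadj hv
    have := hbound (Function.update x c v)
    have := hbound y
    have hGdim := ih _ (by omega) hG rfl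
    have key := (spechtDim_le_matchingVolume_of_parent hac hleaf (huniq x c v hv) hGdim).1
    rw [hself x a c v hac hadj] at key
    exact key (h.slide hac hadj hv)
  · obtain ⟨v, hv⟩ := hfresh y
    have hG := (h.symm.update_left (c := c) hv).symm
    have hlt := card_image_lt_card_image_update hac hadj hv
    have := hbound (Function.update y c v)
    have := hbound x
    have hGdim := ih _ (by omega) hG rfl
    have key := (spechtDim_le_matchingVolume_of_parent hac.symm (huniq y c v hv) hleaf hGdim).2
    rw [hself y a c v hac hadj] at key
    exact key (h.symm.slide hac hadj hv).symm

/-- The leaf recurrence for bipartite multigraphs. -/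
theorem nonempty_edgeSpecht_leaf_recurrence {x y : Fin n → ℕ} {p q : Fin n} (hpq : p ≠ q)
    (hp : ∀ i, y i = y p → i = p) (hq : ∀ i, x i = x q → i = q) (hG : EdgeForest x y)
    (hG₁ : EdgeForest (Function.update x q (x p)) y)
    (hG₂ : EdgeForest x (Function.update y p (y q))) :
    Nonempty (edgeSpecht x y ≃ₗ[MonoidAlgebra ℂ (Equiv.Perm (Fin n))]
      edgeSpecht (Function.update x q (x p)) y × edgeSpecht x (Function.update y p (y q))) := by
  refine nonempty_edgeSpecht_equiv_prod hpq hp hq ?_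
  have h : (spechtDim x y : ENNReal) ≤ spechtDim (Function.update x q (x p)) y +
      spechtDim x (Function.update y p (y q)) :=
    (spechtDim_le_matchingVolume hG).trans ((matchingVolume_le_add hpq hp hq).trans
      (add_le_add (matchingVolume_le_spechtDim hG₁) (matchingVolume_le_spechtDim hG₂)))
  exact_mod_cast h

end DimensionFormula

/-! ### From endpoint functions back to diagrams of graphs. -/

section Diagrams

variable {n : ℕ} {α β : Type*}

/-- The recurrence is proved with labels in `ℕ`, where fresh vertices always exist; injective
relabelling transfers it. -/
theorem nonempty_edgeSpecht_leaf_recurrence_of_countable [Countable α] [Countable β]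
    {x : Fin n → α} {y : Fin n → β} {p q : Fin n} (hpq : p ≠ q)
    (hp : ∀ i, y i = y p → i = p) (hq : ∀ i, x i = x q → i = q) (hG : EdgeForest x y)
    (hG₁ : EdgeForest (Function.update x q (x p)) y)
    (hG₂ : EdgeForest x (Function.update y p (y q))) :
    Nonempty (edgeSpecht x y ≃ₗ[MonoidAlgebra ℂ (Equiv.Perm (Fin n))]
      edgeSpecht (Function.update x q (x p)) y × edgeSpecht x (Function.update y p (y q))) := by
  obtain ⟨ι, hι⟩ := exists_injective_nat α
  obtain ⟨κ, hκ⟩ := exists_injective_nat β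
  have hx : ι ∘ Function.update x q (x p) = Function.update (ι ∘ x) q ((ι ∘ x) p) :=
    Function.comp_update ..
  have hy : κ ∘ Function.update y p (y q) = Function.update (κ ∘ y) p ((κ ∘ y) q) :=
    Function.comp_update ..
  have hforest : ∀ {x' : Fin n → α} {y' : Fin n → β}, EdgeForest x' y' →
      EdgeForest (ι ∘ x') (κ ∘ y') := fun h =>
    h.of_refine (fun _ _ hij => hι hij) (fun _ _ hij => hκ hij)
  have hspecht : ∀ (x' : Fin n → α) (y' : Fin n → β),
      edgeSpecht x' y' = edgeSpecht (ι ∘ x') (κ ∘ y') := fun x' y' =>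
    edgeSpecht_congr (fun _ _ => hι.eq_iff.symm) (fun _ _ => hκ.eq_iff.symm)
  rw [hspecht x y, hspecht _ y, hspecht x, hx, hy]
  exact nonempty_edgeSpecht_leaf_recurrence hpq (fun i hi => hp i (hκ hi))
    (fun i hi => hq i (hι hi)) (hforest hG) (hx ▸ hforest hG₁) (hy ▸ hforest hG₂)

theorem nonempty_spechtModule_equiv_edgeSpecht {α' β' E : Type*} {D : Set (α × β)}
    (e : Fin n ≃ D) (t : Fin n ≃ E) (φ : E ≃ D) {x : E → α'} {y : E → β'}
    (hx : ∀ i j, (φ i).1.1 = (φ j).1.1 ↔ x i = x j)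
    (hy : ∀ i j, (φ i).1.2 = (φ j).1.2 ↔ y i = y j) :
    Nonempty (spechtModule e ≃ₗ[MonoidAlgebra ℂ (Equiv.Perm (Fin n))]
      edgeSpecht (x ∘ t) (y ∘ t)) := by
  set τ : Equiv.Perm (Fin n) := (e.trans φ.symm).trans t.symm with hτ
  have he : ∀ i, e i = φ (t (τ i)) := fun i => by simp [hτ]
  have h1 : spechtModule e = edgeSpecht ((x ∘ t) ∘ τ) ((y ∘ t) ∘ τ) := by
    rw [spechtModule_eq_edgeSpecht]
    refine edgeSpecht_congr (fun i j => ?_) (fun i j => ?_)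
    · rw [he, he]
      exact hx _ _
    · rw [he, he]
      exact hy _ _
  rw [h1]
  exact nonempty_edgeSpecht_reorder _ _ τ

theorem EdgeForest.of_equiv {α' β' E : Type*} {D : Set (α × β)}
    (hD : EdgeForest (fun d : D => d.1.1) (fun d => d.1.2)) (φ : E ≃ D) (t : Fin n ≃ E)
    {x : E → α'} {y : E → β'} (hx : ∀ i j, (φ i).1.1 = (φ j).1.1 ↔ x i = x j)
    (hy : ∀ i j, (φ i).1.2 = (φ j).1.2 ↔ y i = y j) : EdgeForest (x ∘ t) (y ∘ t) :=
  ((hD.comp φ.injective).comp t.injective).of_refine (fun _ _ h => (hx _ _).mpr h)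
    (fun _ _ h => (hy _ _).mpr h)

namespace BipartitionedGraph

variable {V : Type*}

/-- The edges in `F` span an acyclic subgraph; the component of one of them is a nontrivial tree,
and the edge at a degree-one vertex of it is the required leaf edge. -/
theorem edgeForest_of_isAcyclic [Finite V] (G : BipartitionedGraph V) (hG : G.graph.IsAcyclic) :
    EdgeForest (fun d : G.diagram => d.1.1) (fun d => d.1.2) := by
  classical
  have := Fintype.ofFinite V
  intro F ⟨d₀, hd₀⟩
  let K : SimpleGraph V := SimpleGraph.fromRel fun u v => ∃ d ∈ F, d.1 = (u, v)
  have hne : ∀ d : G.diagram, d.1.1 ≠ d.1.2 := fun d => d.2.2.2.ne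
  have hadj : ∀ d ∈ F, K.Adj d.1.1 d.1.2 := fun d hd => by
    rw [SimpleGraph.fromRel_adj]
    exact ⟨hne d, Or.inl ⟨d, hd, rfl⟩⟩
  have hle : K ≤ G.graph := by
    intro u v huv
    rw [SimpleGraph.fromRel_adj] at huv
    obtain ⟨-, ⟨d, -, hd⟩ | ⟨d, -, hd⟩⟩ := huv
    · have := d.2.2.2
      rwa [hd] at this
    · have := d.2.2.2
      rw [hd] at this
      exact this.symm
  have hK := SimpleGraph.IsAcyclic.anti hle hG
  set c := K.connectedComponentMk d₀.1.1 with hc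
  have htree := hK.isTree_connectedComponent c
  have hmem1 : d₀.1.1 ∈ c.supp := rfl
  have hmem2 : d₀.1.2 ∈ c.supp := by
    rw [SimpleGraph.ConnectedComponent.mem_supp_iff, hc, SimpleGraph.ConnectedComponent.eq]
    exact (hadj d₀ hd₀).symm.reachable
  have : Nontrivial c.supp :=
    ⟨⟨_, hmem1⟩, ⟨_, hmem2⟩, fun h => hne d₀ (congrArg Subtype.val h)⟩
  obtain ⟨⟨v, hv⟩, hdeg⟩ := htree.exists_vert_degree_one_of_nontrivial
  rw [SimpleGraph.degree_eq_one_iff_existsUnique_adj] at hdeg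
  obtain ⟨⟨u, hu⟩, huv, huniq⟩ := hdeg
  have huv' : K.Adj v u := huv
  have huniq' : ∀ u', K.Adj v u' → u' = u := by
    intro u' hu'
    have hmem : u' ∈ c.supp := by
      rw [SimpleGraph.ConnectedComponent.mem_supp_iff,
        ← (SimpleGraph.ConnectedComponent.mem_supp_iff c v).mp hv, SimpleGraph.ConnectedComponent.eq]
      exact hu'.symm.reachable
    exact congrArg Subtype.val (huniq ⟨u', hmem⟩ hu')
  rw [SimpleGraph.fromRel_adj] at huv'
  obtain ⟨-, ⟨d, hdF, hd⟩ | ⟨d, hdF, hd⟩⟩ := huv'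
  · refine ⟨d, hdF, Or.inl fun j hj hji => ?_⟩
    have hjv : j.1.1 = v := hji.trans (congrArg Prod.fst hd)
    have h := huniq' j.1.2 (hjv ▸ hadj j hj)
    exact Subtype.ext (Prod.ext hji (by rw [h, hd]))
  · refine ⟨d, hdF, Or.inr fun j hj hji => ?_⟩
    have hjv : j.1.2 = v := hji.trans (congrArg Prod.snd hd)
    have h := huniq' j.1.1 (hjv ▸ (hadj j hj).symm)
    exact Subtype.ext (Prod.ext (by rw [h, hd]) hji)

/-- White endpoints of the edges of `H` with a pendant edge `none` at the white vertex `w` and a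
pendant edge `some none` at a black vertex. -/
def pendantWhite (H : BipartitionedGraph V) (w : V) : Option (Option H.diagram) → Option V
  | none => some w
  | some none => none
  | some (some h) => some h.1.1

/-- Black endpoints of the edges of `H` with a pendant edge `none` at a white vertex and a pendant
edge `some none` at the black vertex `b`. -/
def pendantBlack (H : BipartitionedGraph V) (b : V) : Option (Option H.diagram) → Option V
  | none => none
  | some none => some b
  | some (some h) => some h.1.2

/-- White endpoints after the edge at `b` has been moved to `w`. -/
def joinedWhite (H : BipartitionedGraph V) (w : V) : Option (Option H.diagram) → Option V
  | none => some w
  | some none => some w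
  | some (some h) => some h.1.1

/-- Black endpoints after the edge at `w` has been moved to `b`. -/
def joinedBlack (H : BipartitionedGraph V) (b : V) : Option (Option H.diagram) → Option V
  | none => some b
  | some none => some b
  | some (some h) => some h.1.2

/-- The three edge sets share the index type consisting of the edges of `H` and two extra ones, so
one ordering `t` serves all three and the children become `Function.update`s of `G`. -/
theorem leaf_recurrence_of_endpoints [Finite V] (H : BipartitionedGraph V) (w b : V)
    {A B C : Type*} {D : Set (A × A)} {D₁ : Set (B × B)} {D₂ : Set (C × C)}
    (φ : Option (Option H.diagram) ≃ D) (φ₁ : Option (Option H.diagram) ≃ D₁)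
    (φ₂ : Option (Option H.diagram) ≃ D₂)
    (hx : ∀ i j, (φ i).1.1 = (φ j).1.1 ↔ H.pendantWhite w i = H.pendantWhite w j)
    (hy : ∀ i j, (φ i).1.2 = (φ j).1.2 ↔ H.pendantBlack b i = H.pendantBlack b j)
    (hx₁ : ∀ i j, (φ₁ i).1.1 = (φ₁ j).1.1 ↔ H.joinedWhite w i = H.joinedWhite w j)
    (hy₁ : ∀ i j, (φ₁ i).1.2 = (φ₁ j).1.2 ↔ H.pendantBlack b i = H.pendantBlack b j)
    (hx₂ : ∀ i j, (φ₂ i).1.1 = (φ₂ j).1.1 ↔ H.pendantWhite w i = H.pendantWhite w j)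
    (hy₂ : ∀ i j, (φ₂ i).1.2 = (φ₂ j).1.2 ↔ H.joinedBlack b i = H.joinedBlack b j)
    (hD : EdgeForest (fun d : D => d.1.1) (fun d => d.1.2))
    (hD₁ : EdgeForest (fun d : D₁ => d.1.1) (fun d => d.1.2))
    (hD₂ : EdgeForest (fun d : D₂ => d.1.1) (fun d => d.1.2))
    (e : Fin n ≃ D) (e₁ : Fin n ≃ D₁) (e₂ : Fin n ≃ D₂) :
    Nonempty (spechtModule e ≃ₗ[MonoidAlgebra ℂ (Equiv.Perm (Fin n))]
      (spechtModule e₁ × spechtModule e₂)) := by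
  set t : Fin n ≃ Option (Option H.diagram) := e.trans φ.symm with ht
  obtain ⟨f⟩ := nonempty_spechtModule_equiv_edgeSpecht e t φ hx hy
  obtain ⟨f₁⟩ := nonempty_spechtModule_equiv_edgeSpecht e₁ t φ₁ hx₁ hy₁
  obtain ⟨f₂⟩ := nonempty_spechtModule_equiv_edgeSpecht e₂ t φ₂ hx₂ hy₂
  set p : Fin n := t.symm none with hp
  set q : Fin n := t.symm (some none) with hq
  have hpq : p ≠ q := fun h => by simpa using t.symm.injective h
  have hwhite : H.joinedWhite w ∘ t =
      Function.update (H.pendantWhite w ∘ t) q ((H.pendantWhite w ∘ t) p) := by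
    funext i
    obtain ⟨i, rfl⟩ := t.symm.surjective i
    rcases i with _ | _ | h
    · rw [← hp, Function.update_of_ne hpq]
      simp [hp, joinedWhite, pendantWhite]
    · rw [Function.update_self]
      simp [hp, joinedWhite, pendantWhite]
    · rw [Function.update_of_ne (fun h' => by simpa using t.symm.injective h')]
      simp [joinedWhite, pendantWhite]
  have hblack : H.joinedBlack b ∘ t =
      Function.update (H.pendantBlack b ∘ t) p ((H.pendantBlack b ∘ t) q) := by
    funext i
    obtain ⟨i, rfl⟩ := t.symm.surjective i
    rcases i with _ | _ | h
    · rw [Function.update_self]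
      simp [hq, joinedBlack, pendantBlack]
    · rw [← hq, Function.update_of_ne hpq.symm]
      simp [hq, joinedBlack, pendantBlack]
    · rw [Function.update_of_ne (fun h' => by simpa using t.symm.injective h')]
      simp [joinedBlack, pendantBlack]
  have h1 := hD₁.of_equiv φ₁ t hx₁ hy₁
  have h2 := hD₂.of_equiv φ₂ t hx₂ hy₂
  rw [hwhite] at f₁ h1
  rw [hblack] at f₂ h2
  have hp' : ∀ i, (H.pendantBlack b ∘ t) i = (H.pendantBlack b ∘ t) p → i = p := by
    intro i hi
    obtain ⟨i, rfl⟩ := t.symm.surjective i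
    rcases i with _ | _ | h <;> simp [hp, pendantBlack] at hi ⊢
  have hq' : ∀ i, (H.pendantWhite w ∘ t) i = (H.pendantWhite w ∘ t) q → i = q := by
    intro i hi
    obtain ⟨i, rfl⟩ := t.symm.surjective i
    rcases i with _ | _ | h <;> simp [hq, pendantWhite] at hi ⊢
  obtain ⟨g⟩ := nonempty_edgeSpecht_leaf_recurrence_of_countable hpq hp' hq'
    (hD.of_equiv φ t hx hy) h1 h2
  exact ⟨(f.trans g).trans (LinearEquiv.prodCongr f₁.symm f₂.symm)⟩

end BipartitionedGraph

end Diagrams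

/-! ### Diagrams of the three graphs of the recurrence. -/

section LeafDiagrams

namespace BipartitionedGraph

variable {V : Type*}

theorem addPendant_diagram_of_white {K : BipartitionedGraph V} {w : V} (hw : K.color w = true) :
    (K.addPendant w).diagram =
      insert (some w, none) ((fun p : V × V => (some p.1, some p.2)) '' K.diagram) := by
  ext ⟨_ | u, _ | v⟩
  · simp [diagram, addPendant]
  · simp [diagram, addPendant, hw]
  · simp only [diagram, addPendant, Set.mem_ofPred_eq, Set.mem_insert_iff, Prod.mk.injEq,
      Option.some.injEq, Set.mem_image, reduceCtorEq, and_false, exists_false, or_false, and_true]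
    constructor
    · exact fun h => h.2.2
    · rintro rfl; simp [hw]
  · simp [diagram, addPendant]

theorem addPendant_diagram_of_black {K : BipartitionedGraph V} {b : V} (hb : K.color b = false) :
    (K.addPendant b).diagram =
      insert (none, some b) ((fun p : V × V => (some p.1, some p.2)) '' K.diagram) := by
  ext ⟨_ | u, _ | v⟩
  · simp [diagram, addPendant]
  · simp only [diagram, addPendant, Set.mem_ofPred_eq, Set.mem_insert_iff, Prod.mk.injEq,
      Option.some.injEq, Set.mem_image, reduceCtorEq, false_and, and_false, exists_false, or_false,
      true_and]
    constructor
    · exact fun h => h.2.2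
    · rintro rfl; simp [hb]
  · simp [diagram, addPendant, hb]
  · simp [diagram, addPendant]

theorem addEdge_diagram_of_white_black {H : BipartitionedGraph V} {w b : V}
    (hw : H.color w = true) (hb : H.color b = false) (h : H.color w ≠ H.color b) :
    (H.addEdge w b h).diagram = insert (w, b) H.diagram := by
  have hwb : w ≠ b := fun h' => h (by rw [h'])
  ext ⟨u, v⟩
  simp only [diagram, addEdge, Set.mem_ofPred_eq, Set.mem_insert_iff, Prod.mk.injEq,
    SimpleGraph.sup_adj, SimpleGraph.edge_adj]
  constructor
  · rintro ⟨hu, hv, h1 | ⟨⟨rfl, rfl⟩ | ⟨rfl, rfl⟩, -⟩⟩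
    · exact Or.inr ⟨hu, hv, h1⟩
    · exact Or.inl ⟨rfl, rfl⟩
    · simp [hw] at hv
  · rintro (⟨rfl, rfl⟩ | ⟨hu, hv, h1⟩)
    · exact ⟨hw, hb, Or.inr ⟨Or.inl ⟨rfl, rfl⟩, hwb⟩⟩
    · exact ⟨hu, hv, Or.inl h1⟩

theorem addEdge_diagram_of_black_white {H : BipartitionedGraph V} {w b : V}
    (hw : H.color w = true) (hb : H.color b = false) (h : H.color b ≠ H.color w) :
    (H.addEdge b w h).diagram = insert (w, b) H.diagram := by
  rw [← addEdge_diagram_of_white_black hw hb h.symm]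
  ext ⟨u, v⟩
  simp only [diagram, addEdge, Set.mem_ofPred_eq, SimpleGraph.edge_comm]

theorem range_option_option {E A : Type*} (f : Option (Option E) → A) :
    Set.range f = insert (f none) (insert (f (some none)) (Set.range fun i => f (some (some i)))) := by
  ext a
  simp only [Set.mem_range, Set.mem_insert_iff]
  constructor
  · rintro ⟨_ | _ | i, rfl⟩
    · exact Or.inl rfl
    · exact Or.inr (Or.inl rfl)
    · exact Or.inr (Or.inr ⟨i, rfl⟩)
  · rintro (rfl | rfl | ⟨i, rfl⟩)
    · exact ⟨_, rfl⟩
    · exact ⟨_, rfl⟩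
    · exact ⟨_, rfl⟩

theorem range_subtype_map {A B : Type*} (S : Set A) (g : A → B) :
    (Set.range fun i : S => g i.1) = g '' S := by
  ext b
  simp

/-- The equivalence onto a set parametrized by an injective map. -/
noncomputable def equivOfRange {E A : Type*} {D : Set A} (f : E → A) (hf : Function.Injective f)
    (hD : Set.range f = D) : E ≃ D :=
  (Equiv.ofInjective f hf).trans (Equiv.setCongr hD)

variable (H : BipartitionedGraph V) {w b : V}

theorem pendant_injective :
    Function.Injective fun i => (H.pendantWhite w i, H.pendantBlack b i) := by
  rintro (_ | _ | ⟨⟨u, v⟩, h⟩) (_ | _ | ⟨⟨u', v'⟩, h'⟩) hij <;>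
    simp_all [pendantWhite, pendantBlack]

/-- Non-adjacency keeps the box of the new edge apart from those of `H`. -/
theorem joinedWhite_injective (hwb : ¬ H.graph.Adj w b) :
    Function.Injective fun i => (H.joinedWhite w i, H.pendantBlack b i) := by
  have hwb' : (w, b) ∉ H.diagram := fun h => hwb h.2.2
  rintro (_ | _ | ⟨⟨u, v⟩, h⟩) (_ | _ | ⟨⟨u', v'⟩, h'⟩) hij <;>
    simp_all [joinedWhite, pendantBlack]
  exact hwb' (by rw [← hij.1, ← hij.2]; exact h)

theorem joinedBlack_injective (hwb : ¬ H.graph.Adj w b) :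
    Function.Injective fun i => (H.pendantWhite w i, H.joinedBlack b i) := by
  have hwb' : (w, b) ∉ H.diagram := fun h => hwb h.2.2
  rintro (_ | _ | ⟨⟨u, v⟩, h⟩) (_ | _ | ⟨⟨u', v'⟩, h'⟩) hij <;>
    simp_all [pendantWhite, joinedBlack]
  exact hwb' (by rw [← hij.1, ← hij.2]; exact h)

theorem range_joinedWhite {K : BipartitionedGraph V} (hw : K.color w = true)
    (hK : K.diagram = insert (w, b) H.diagram) :
    (Set.range fun i => (H.joinedWhite w i, H.pendantBlack b i)) = (K.addPendant w).diagram := by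
  rw [addPendant_diagram_of_white hw, hK, Set.image_insert_eq, range_option_option,
    ← range_subtype_map H.diagram]
  rfl

theorem range_joinedBlack {K : BipartitionedGraph V} (hb : K.color b = false)
    (hK : K.diagram = insert (w, b) H.diagram) :
    (Set.range fun i => (H.pendantWhite w i, H.joinedBlack b i)) = (K.addPendant b).diagram := by
  rw [addPendant_diagram_of_black hb, hK, Set.image_insert_eq, range_option_option,
    ← range_subtype_map H.diagram, Set.insert_comm]
  rfl

theorem range_pendant_white_black (hw : H.color w = true) (hb : H.color b = false) :
    (Set.range fun i => ((H.pendantWhite w i).map some, some (H.pendantBlack b i))) =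
      (H.leafG w b).diagram := by
  rw [leafG, addPendant_diagram_of_black (K := H.addPendant w) (b := some b) hb,
    addPendant_diagram_of_white hw, Set.image_insert_eq, Set.image_image, range_option_option,
    ← range_subtype_map H.diagram, Set.insert_comm]
  rfl

theorem range_pendant_black_white (hw : H.color w = true) (hb : H.color b = false) :
    (Set.range fun i => (some (H.pendantWhite w i), (H.pendantBlack b i).map some)) =
      (H.leafG b w).diagram := by
  rw [leafG, addPendant_diagram_of_white (K := H.addPendant b) (w := some w) hw,
    addPendant_diagram_of_black hb, Set.image_insert_eq, Set.image_image, range_option_option,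
    ← range_subtype_map H.diagram]
  rfl

end BipartitionedGraph

end LeafDiagrams

theorem mainTheorem3 {V : Type*} [Finite V] (H : BipartitionedGraph V) (v₁ v₂ : V)
    (hcolor : H.color v₁ ≠ H.color v₂) (hadj : ¬ H.graph.Adj v₁ v₂)
    (hG : (H.leafG v₁ v₂).graph.IsAcyclic)
    (hG₁ : (H.leafG₁ v₁ v₂ hcolor).graph.IsAcyclic)
    (hG₂ : (H.leafG₂ v₁ v₂ hcolor).graph.IsAcyclic)
    (n : ℕ) (hn : Nat.card (H.leafG v₁ v₂).diagram = n) :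
    Nat.card (H.leafG₁ v₁ v₂ hcolor).diagram = n ∧
    Nat.card (H.leafG₂ v₁ v₂ hcolor).diagram = n ∧
    ∀ (e : Fin n ≃ (H.leafG v₁ v₂).diagram)
      (e₁ : Fin n ≃ (H.leafG₁ v₁ v₂ hcolor).diagram)
      (e₂ : Fin n ≃ (H.leafG₂ v₁ v₂ hcolor).diagram),
      Nonempty (spechtModule e ≃ₗ[MonoidAlgebra ℂ (Equiv.Perm (Fin n))]
        (spechtModule e₁ × spechtModule e₂)) := by
  have hmap : Function.Injective (Option.map (some : V → Option V)) :=
    Option.map_injective (Option.some_injective V)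
  have hsome := Option.some_injective (Option V)
  have hF := BipartitionedGraph.edgeForest_of_isAcyclic _ hG
  have hF₁ := BipartitionedGraph.edgeForest_of_isAcyclic _ hG₁
  have hF₂ := BipartitionedGraph.edgeForest_of_isAcyclic _ hG₂
  rcases hc : H.color v₁ with _ | _
  -- With `v₁` black, the pendant edge of `leafG₁` hangs at the black vertex, so `leafG₁` and
  -- `leafG₂` trade roles and the product is swapped at the end.
  · have hw : H.color v₂ = true := by
      rw [hc] at hcolor
      simpa using hcolor.symm
    have hadj' : ¬ H.graph.Adj v₂ v₁ := fun h => hadj h.symm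
    have hK := BipartitionedGraph.addEdge_diagram_of_black_white hw hc hcolor
    let φ := BipartitionedGraph.equivOfRange
      (fun i => (some (H.pendantWhite v₂ i), (H.pendantBlack v₁ i).map some))
      (fun i j h => H.pendant_injective (Prod.ext (hsome (Prod.ext_iff.mp h).1)
        (hmap (Prod.ext_iff.mp h).2))) (H.range_pendant_black_white hw hc)
    let φ₁ := BipartitionedGraph.equivOfRange _ (H.joinedBlack_injective hadj')
      (H.range_joinedBlack (K := H.addEdge v₁ v₂ hcolor) hc hK)
    let φ₂ := BipartitionedGraph.equivOfRange _ (H.joinedWhite_injective hadj')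
      (H.range_joinedWhite (K := H.addEdge v₁ v₂ hcolor) hw hK)
    refine ⟨?_, ?_, fun e e₁ e₂ => ?_⟩
    · rw [← hn]
      exact Nat.card_congr (φ₁.symm.trans φ)
    · rw [← hn]
      exact Nat.card_congr (φ₂.symm.trans φ)
    · obtain ⟨f⟩ := BipartitionedGraph.leaf_recurrence_of_endpoints H v₂ v₁ φ φ₂ φ₁
        (fun _ _ => hsome.eq_iff) (fun _ _ => hmap.eq_iff) (fun _ _ => Iff.rfl) (fun _ _ => Iff.rfl)
        (fun _ _ => Iff.rfl) (fun _ _ => Iff.rfl) hF hF₂ hF₁ e e₂ e₁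
      exact ⟨f.trans (LinearEquiv.prodComm _ _ _)⟩
  · have hb : H.color v₂ = false := by
      rw [hc] at hcolor
      simpa using hcolor.symm
    have hK := BipartitionedGraph.addEdge_diagram_of_white_black hc hb hcolor
    let φ := BipartitionedGraph.equivOfRange
      (fun i => ((H.pendantWhite v₁ i).map some, some (H.pendantBlack v₂ i)))
      (fun i j h => H.pendant_injective (Prod.ext (hmap (Prod.ext_iff.mp h).1)
        (hsome (Prod.ext_iff.mp h).2))) (H.range_pendant_white_black hc hb)
    let φ₁ := BipartitionedGraph.equivOfRange _ (H.joinedWhite_injective hadj)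
      (H.range_joinedWhite (K := H.addEdge v₁ v₂ hcolor) hc hK)
    let φ₂ := BipartitionedGraph.equivOfRange _ (H.joinedBlack_injective hadj)
      (H.range_joinedBlack (K := H.addEdge v₁ v₂ hcolor) hb hK)
    refine ⟨?_, ?_, fun e e₁ e₂ => ?_⟩
    · rw [← hn]
      exact Nat.card_congr (φ₁.symm.trans φ)
    · rw [← hn]
      exact Nat.card_congr (φ₂.symm.trans φ)
    · exact BipartitionedGraph.leaf_recurrence_of_endpoints H v₁ v₂ φ φ₁ φ₂
        (fun _ _ => hmap.eq_iff) (fun _ _ => hsome.eq_iff) (fun _ _ => Iff.rfl) (fun _ _ => Iff.rfl)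
        (fun _ _ => Iff.rfl) (fun _ _ => Iff.rfl) hF hF₁ hF₂ e e₁ e₂
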